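/- Let $d\ge 1$, let $\Gamma\in\mathbb R^{d\times d}$, let $\Sigma_0,Q\in\mathbb R^{d\times d}$ be positive semidefinite and $\sigma>0$. Consider the linear Gaussian dynamical system $z_{t+1}=\Gamma z_t+\xi_t$, $X_t=\langle a_t,z_t\rangle+\eta_t$ $(t\ge 0)$, where $z_0\sim\mathcal N(0,\Sigma_0)$, $\xi_t\sim\mathcal N(0,Q)$, $\eta_t\sim\mathcal N(0,\sigma^2)$ are mutually independent, and the action $a_t$ is a unit vector of $\mathbb R^d$ that is a measurable function of $X_0,\dots,X_{t-1}$. Put $\mathcal F_t=\sigma(X_0,\dots,X_t)$ ($\mathcal F_{-1}$ trivial), $\hat z_{t|t-1}=\mathbb E[z_t\mid\mathcal F_{t-1}]$, $e_{t|t-1}=z_t-\hat z_{t|t-1}$, $P_{t|t-1}=\mathbb E[e_{t|t-1}e_{t|t-1}^\top\mid\mathcal F_{t-1}]$, and $$g(P,a)=\Gamma P\Gamma^\top+Q-\Gamma Pa\,(a^\top Pa+\sigma^2)^{-1}a^\top P\Gamma^\top .$$ For a horizon $n\ge 2$ define, for each choice of the earlier actions, the value functions $$V_n=\max_{a}\mathbb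 E[\langle a,z_n\rangle\mid\mathcal F_{n-1}],\qquad V_t=\max_{a}\mathbb E[\langle a,z_t\rangle+V_{t+1}\mid\mathcal F_{t-1}]\quad(t=n-1,\dots,1),$$ where the maximum, for the almost sure order, is over the unit vectors $a$ that are measurable functions of the past observations $X_0,\dots,X_{t-1}$, and $V_{t+1}$ is taken after the action $a_t=a$. Then the following holds. 1. Almost surely $V_n=\|\hat z_{n|n-1}\|_2$. 2. Almost surely $$V_{n-1}=\max_{a}\Big\{\langle a,\hat z_{n-1|n-2}\rangle+\mathbb E\Big[\sqrt{\mathbb E[\|z_n\|_2^2\mid\mathcal F_{n-1}]-\operatorname{tr} g(P_{n-1|n-2},a)}\;\Big|\;\mathcal F_{n-2}\Big]\Big\},$$ where $\mathcal F_{n-1}$ is generated by the observations when $a_{n-1}=a$. The maximum is attained; for every $a$ the radicand is almost surely nonnegative and its square root is integrable; and the error covariance after the action $a$ is $P_{n|n-1}=g(P_{n-1|n-2},a)$ almost surely. 3. The expression under the conditional expectation is nonlinear in the second moment and in the error covariance matrix: for every unit vector $a$ and every positive semidefinite $P$, the function $m\mapsto\sqrt{m-\operatorname{tr}g(P,a)}$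 on $\{m\ge\operatorname{tr}g(P,a)\}$ is not affine; and, if $\Gamma\ne0$, for every unit vector $a$ and every $m>\operatorname{tr}Q$ the function $P\mapsto\sqrt{m-\operatorname{tr}g(P,a)}$ on $\{P\succeq0:\operatorname{tr}g(P,a)\le m\}$ is not affine. 4. The action enters the error covariance nonlinearly, so that control and estimation are not separated: if $d\ge2$, $\Gamma\neq0$ and $(\Gamma,Q^{1/2})$ is controllable, then almost surely the map $a\mapsto g(P_{n-1|n-2},a)$ on the unit sphere is not the restriction of an affine map (in particular it is not constant). -/

import Mathlib

open MeasureTheory ProbabilityTheory Matrix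
open scoped MatrixOrder

noncomputable section

/-- Parameters of a linear Gaussian dynamical system in `ℝ^d`: state matrix `Γ`, covariance `S₀` of
the initial state, covariance `Q` of the process noise, and standard deviation `σ > 0` of the
measurement noise. -/
structure LGDS (d : ℕ) where
  Γ : Matrix (Fin d) (Fin d) ℝ
  S₀ : Matrix (Fin d) (Fin d) ℝ
  Q : Matrix (Fin d) (Fin d) ℝ
  σ : ℝ
  S₀_psd : S₀.PosSemidef
  Q_psd : Q.PosSemidef
  σ_pos : 0 < σ

/-- The primitive random variables of the system on a probability space: the initial state
`z₀ ∼ N(0, S₀)`, the process noise `ξ t ∼ N(0, Q)` and the measurement noise `η t ∼ N(0, σ²)`,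
all of them mutually independent. -/
structure LGDS.Realization {d : ℕ} (M : LGDS d) {Ω : Type*} [MeasurableSpace Ω]
    (μ : Measure Ω) where
  z₀ : Ω → EuclideanSpace ℝ (Fin d)
  ξ : ℕ → Ω → EuclideanSpace ℝ (Fin d)
  η : ℕ → Ω → ℝ
  measurable_z₀ : Measurable z₀
  measurable_ξ : ∀ t, Measurable (ξ t)
  measurable_η : ∀ t, Measurable (η t)
  law_z₀ : μ.map z₀ = multivariateGaussian 0 M.S₀
  law_ξ : ∀ t, μ.map (ξ t) = multivariateGaussian 0 M.Q
  law_η : ∀ t, μ.map (η t) = gaussianReal 0 (M.σ ^ 2).toNNReal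
  indep : iIndep (fun i : Unit ⊕ ℕ ⊕ ℕ =>
    Sum.elim (fun _ => MeasurableSpace.comap z₀ inferInstance)
      (Sum.elim (fun t => MeasurableSpace.comap (ξ t) inferInstance)
        (fun t => MeasurableSpace.comap (η t) inferInstance)) i) μ

/-- The Riccati update
`g(P, a) = Γ P Γᵀ + Q - Γ P a (aᵀ P a + σ²)⁻¹ aᵀ P Γᵀ`. -/
def LGDS.g {d : ℕ} (M : LGDS d) (P : Matrix (Fin d) (Fin d) ℝ)
    (a : EuclideanSpace ℝ (Fin d)) : Matrix (Fin d) (Fin d) ℝ :=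
  M.Γ * P * M.Γᵀ + M.Q
    - (a.ofLp ⬝ᵥ (P *ᵥ a.ofLp) + M.σ ^ 2)⁻¹ •
      (M.Γ * P * vecMulVec a.ofLp a.ofLp * P * M.Γᵀ)

/-- Controllability of the pair `(A, B)`: the columns of `B, A B, …, A^(d-1) B` span `ℝ^d`. -/
def IsControllable {d : ℕ} (A B : Matrix (Fin d) (Fin d) ℝ) : Prop :=
  (⨆ k : Fin d, LinearMap.range (Matrix.mulVecLin (A ^ (k : ℕ) * B))) = ⊤

/-- `V` is the maximum of the set `S` of random variables for the almost sure order: `V` dominates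
every member of `S` almost surely, and it is almost surely equal to a member of `S`. -/
def IsAEMax {Ω : Type*} [MeasurableSpace Ω] (μ : Measure Ω) (S : Set (Ω → ℝ)) (V : Ω → ℝ) : Prop :=
  (∀ f ∈ S, f ≤ᵐ[μ] V) ∧ ∃ f ∈ S, V =ᵐ[μ] f

open Classical in
/-- The maximum of a set of random variables for the almost sure order (unique up to almost sure
equality), or `0` if there is no maximum. -/
def aeMax {Ω : Type*} [MeasurableSpace Ω] (μ : Measure Ω) (S : Set (Ω → ℝ)) : Ω → ℝ :=
  if h : ∃ V, IsAEMax μ S V then h.choose else 0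

namespace LGDS.Realization

variable {d : ℕ} {M : LGDS d} {Ω : Type*} [MeasurableSpace Ω] {μ : Measure Ω}

/-- The state: `z 0 = z₀`, `z (t + 1) = Γ z t + ξ t`. -/
def state (R : M.Realization μ) : ℕ → Ω → EuclideanSpace ℝ (Fin d)
  | 0 => R.z₀
  | t + 1 => fun ω => WithLp.toLp 2 (M.Γ *ᵥ (state R t ω).ofLp) + R.ξ t ω

/-- The reward `X t = ⟨a t, z t⟩ + η t` observed at time `t` under the action process `a`. -/
def reward (R : M.Realization μ) (a : ℕ → Ω → EuclideanSpace ℝ (Fin d)) (t : ℕ) (ω : Ω) : ℝ :=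
  inner ℝ (a t ω) (R.state t ω) + R.η t ω

/-- The `σ`-algebra `F_{t-1}` generated by the rewards `X 0, …, X (t-1)` observed before time `t`.
It depends only on the actions taken before time `t`. -/
@[reducible]
def past (R : M.Realization μ) (a : ℕ → Ω → EuclideanSpace ℝ (Fin d)) (t : ℕ) :
    MeasurableSpace Ω :=
  ⨆ s : Fin t, MeasurableSpace.comap (R.reward a s) inferInstance

/-- `α` is a possible action at time `t`: a unit vector chosen as a function of the rewards observed
before time `t`. -/
def IsAction (R : M.Realization μ) (a : ℕ → Ω → EuclideanSpace ℝ (Fin d)) (t : ℕ)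
    (α : Ω → EuclideanSpace ℝ (Fin d)) : Prop :=
  Measurable[R.past a t] α ∧ ∀ ω, ‖α ω‖ = 1

/-- The actions `a 0, …, a (t-1)` are possible ones. -/
def AdmissibleBefore (R : M.Realization μ) (t : ℕ) (a : ℕ → Ω → EuclideanSpace ℝ (Fin d)) : Prop :=
  ∀ s < t, R.IsAction a s (a s)

/-- The one-step prediction `ẑ_{t|t-1} = E[z t | F_{t-1}]`. -/
def pred (R : M.Realization μ) (a : ℕ → Ω → EuclideanSpace ℝ (Fin d)) (t : ℕ) :
    Ω → EuclideanSpace ℝ (Fin d) :=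
  μ[R.state t | R.past a t]

/-- The prediction error `e_{t|t-1} = z t - ẑ_{t|t-1}`. -/
def err (R : M.Realization μ) (a : ℕ → Ω → EuclideanSpace ℝ (Fin d)) (t : ℕ) (ω : Ω) :
    EuclideanSpace ℝ (Fin d) :=
  R.state t ω - R.pred a t ω

/-- The error covariance matrix `P_{t|t-1} = E[e_{t|t-1} e_{t|t-1}ᵀ | F_{t-1}]`. -/
def errCov (R : M.Realization μ) (a : ℕ → Ω → EuclideanSpace ℝ (Fin d)) (t : ℕ) (ω : Ω) :
    Matrix (Fin d) (Fin d) ℝ :=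
  Matrix.of fun i j => (μ[fun ω' => R.err a t ω' i * R.err a t ω' j | R.past a t]) ω

/-- The conditional second moment `E[‖z t‖² | F_{t-1}]`. -/
def secondMoment (R : M.Realization μ) (a : ℕ → Ω → EuclideanSpace ℝ (Fin d)) (t : ℕ) : Ω → ℝ :=
  μ[fun ω => ‖R.state t ω‖ ^ 2 | R.past a t]

/-- The dynamic programming recursion. `R.valueToGo k t a` is the value function at time `t` when
`k` further decisions follow the one at time `t` and the actions before time `t` were
`a 0, …, a (t-1)`. -/
def valueToGo (R : M.Realization μ) :
    ℕ → ℕ → (ℕ → Ω → EuclideanSpace ℝ (Fin d)) → Ω → ℝ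
  | 0, t, a => aeMax μ {f | ∃ α, R.IsAction a t α ∧
      f = μ[fun ω => inner ℝ (α ω) (R.state t ω) | R.past a t]}
  | k + 1, t, a => aeMax μ {f | ∃ α, R.IsAction a t α ∧
      f = μ[fun ω => inner ℝ (α ω) (R.state t ω)
          + valueToGo R k (t + 1) (Function.update a t α) ω | R.past a t]}

/-- The value function `V_t` of the problem with horizon `n`, for `t ≤ n`:
`V_n = max_α E[⟨α, z n⟩ | F_{n-1}]` and `V_t = max_α E[⟨α, z t⟩ + V_{t+1} | F_{t-1}]`. -/
def value (R : M.Realization μ) (n t : ℕ) (a : ℕ → Ω → EuclideanSpace ℝ (Fin d)) : Ω → ℝ :=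
  R.valueToGo (n - t) t a

end LGDS.Realization

end

/-! The whole theorem rests on the Kalman filter for adaptively chosen actions: given the past, the
state `z t` is Gaussian with past-measurable mean `m` and covariance `P`. Although the action is
random, it is measurable with respect to the past, so conditionally it is frozen and the classical
computation applies. The predicate `IsCondGaussian` encodes this by conditional characteristic
functions; `IsCondGaussian.correct` absorbs a new observation, `IsCondGaussian.predict` applies the
dynamics, and `exists_isCondGaussian` iterates the two. The correction works because the gain makes
the residual of the state uncorrelated with the observation, hence independent of it
(`indepFun_innovation`).

Consequently the prediction is `m`, the error covariance is `P`, and the conditional second moment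
is `‖m‖ ^ 2 + P.trace`. Since the next covariance is `g (P, α)`, the radicand is just the squared
norm of the next prediction (`radicand_ae_eq`). At the last stage Cauchy–Schwarz gives the value
`‖ẑ‖`. One stage earlier, the conditional mean of the next norm is an explicit function
`meanPredictedNorm` of `m`, `P` and the action, continuous in the action on the sphere; a measurable
selection of maximizers (`exists_measurable_argmax`) turns pointwise maximization into an admissible
action that is optimal for the almost sure order.

The nonlinearity claims are deterministic. In the second moment, three points suffice. In `P`, one
restricts to a ray of rank-one matrices, where squaring an affine square root gives an impossible
polynomial identity. In the action, `g (P, ·)` is even, so an affine extension would make it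
constant on the sphere; for `d ≥ 2` this forces `Γ P = 0`, then `Γ Q^{1/2} = 0` because `P ≥ Q`, and
controllability yields `Γ = 0`. -/

noncomputable section

/-! ### Conditional laws from conditional characteristic functions -/

section CondLaw

variable {α β E : Type*} {mα : MeasurableSpace α} {mβ : MeasurableSpace β} {μ : Measure α}
  [IsProbabilityMeasure μ] {X : α → β} {Y : α → E}

/-- The exceptional null set depends on `u`; restricting to a countable dense set of `u` gives a
single null set, and continuity of characteristic functions recovers all `u`. -/
theorem condDistrib_ae_eq_of_condExp_charFun [NormedAddCommGroup E] [InnerProductSpace ℝ E]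
    [CompleteSpace E] [MeasurableSpace E] [BorelSpace E] [SecondCountableTopology E]
    (hX : Measurable X) (hY : Measurable Y) (ν : β → Measure E) [∀ b, IsProbabilityMeasure (ν b)]
    (h : ∀ u, μ[fun ω => Complex.exp ((inner ℝ (Y ω) u : ℝ) * Complex.I) | mβ.comap X]
      =ᵐ[μ] fun ω => charFun (ν (X ω)) u) :
    ∀ᵐ ω ∂μ, condDistrib Y X μ (X ω) = ν (X ω) := by
  have key : ∀ u, ∀ᵐ ω ∂μ, charFun (condDistrib Y X μ (X ω)) u = charFun (ν (X ω)) u := by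
    intro u
    have hm : StronglyMeasurable fun y : E => Complex.exp ((inner ℝ y u : ℝ) * Complex.I) :=
      Measurable.stronglyMeasurable (by fun_prop)
    have h1 := condExp_ae_eq_integral_condDistrib (μ := μ) hX hY.aemeasurable hm
      (Integrable.of_bound (C := 1) (hm.comp_measurable hY).aestronglyMeasurable
        (by filter_upwards with ω; rw [Complex.norm_exp_ofReal_mul_I]))
    filter_upwards [h1, h u] with ω h1 h2
    rw [charFun_apply, ← h1, h2]
  have key' : ∀ᵐ ω ∂μ, ∀ n, charFun (condDistrib Y X μ (X ω)) (TopologicalSpace.denseSeq E n)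
      = charFun (ν (X ω)) (TopologicalSpace.denseSeq E n) := by
    rw [ae_all_iff]; exact fun n => key _
  filter_upwards [key'] with ω hω
  apply Measure.ext_of_charFun
  apply Continuous.ext_on (TopologicalSpace.denseRange_denseSeq E)
    (continuous_charFun) (continuous_charFun)
  rintro _ ⟨n, rfl⟩
  exact hω n

/-- Fresh noise `Z`, independent of `X` and `Y` jointly, keeps its unconditional law. The
disintegration is checked on measurable boxes, where independence splits off the factor of `Z`. -/
theorem condDistrib_prodMk_of_indep {γ : Type*} [MeasurableSpace E] [StandardBorelSpace E]
    [Nonempty E] [MeasurableSpace γ] [StandardBorelSpace γ] [Nonempty γ] {Z : α → γ}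
    (hX : Measurable X) (hY : Measurable Y) (hZ : Measurable Z)
    (hind : Indep (mβ.comap X ⊔ MeasurableSpace.comap Y inferInstance)
      (MeasurableSpace.comap Z inferInstance) μ) :
    ∀ᵐ ω ∂μ, condDistrib (fun ω => (Y ω, Z ω)) X μ (X ω)
      = (condDistrib Y X μ (X ω)).prod (μ.map Z) := by
  have : IsProbabilityMeasure (μ.map Z) := Measure.isProbabilityMeasure_map hZ.aemeasurable
  have h : condDistrib (fun ω => (Y ω, Z ω)) X μ =ᵐ[μ.map X]
      (condDistrib Y X μ) ×ₖ (Kernel.const _ (μ.map Z)) := by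
    refine condDistrib_ae_eq_of_measure_eq_compProd X (hY.prodMk hZ).aemeasurable ?_
    refine Measure.ext_prod₃ fun {s t u} hs ht hu => ?_
    rw [Measure.map_apply (by fun_prop) (hs.prod (ht.prod hu)),
      Measure.compProd_apply (hs.prod (ht.prod hu))]
    have e1 : (fun ω => (X ω, Y ω, Z ω)) ⁻¹' s ×ˢ t ×ˢ u = (X ⁻¹' s ∩ Y ⁻¹' t) ∩ Z ⁻¹' u := by
      ext; simp [and_assoc]
    rw [e1, (Indep_iff _ _ _).1 hind (X ⁻¹' s ∩ Y ⁻¹' t) (Z ⁻¹' u)]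
    rotate_left
    · exact MeasurableSet.inter (le_sup_left (a := mβ.comap X) _ ⟨s, hs, rfl⟩)
        (le_sup_right (a := mβ.comap X) _ ⟨t, ht, rfl⟩)
    · exact ⟨u, hu, rfl⟩
    have e2 : X ⁻¹' s ∩ Y ⁻¹' t = (fun ω => (X ω, Y ω)) ⁻¹' s ×ˢ t := by ext; simp
    rw [e2, ← Measure.map_apply (by fun_prop) (hs.prod ht),
      ← compProd_map_condDistrib hY.aemeasurable, Measure.compProd_apply (hs.prod ht),
      ← Measure.map_apply hZ hu,
      ← lintegral_mul_const _ (Kernel.measurable_kernel_prodMk_left (hs.prod ht))]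
    refine lintegral_congr fun b => ?_
    by_cases hb : b ∈ s
    · simp [hb, Kernel.prod_apply, Measure.prod_prod]
    · simp [hb]
  filter_upwards [ae_of_ae_map hX.aemeasurable h] with ω hω
  rw [hω, Kernel.prod_apply, Kernel.const_apply]

theorem condExp_ae_eq_integral_of_condExp_charFun [NormedAddCommGroup E] [InnerProductSpace ℝ E]
    [CompleteSpace E] [MeasurableSpace E] [BorelSpace E] [SecondCountableTopology E]
    {G : Type*} [NormedAddCommGroup G] [NormedSpace ℝ G] [CompleteSpace G]
    (hX : Measurable X) (hY : Measurable Y) (ν : β → Measure E) [∀ b, IsProbabilityMeasure (ν b)]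
    (h : ∀ u, μ[fun ω => Complex.exp ((inner ℝ (Y ω) u : ℝ) * Complex.I) | mβ.comap X]
      =ᵐ[μ] fun ω => charFun (ν (X ω)) u)
    {f : β × E → G} (hf : StronglyMeasurable f) (hfi : Integrable (fun ω => f (X ω, Y ω)) μ) :
    μ[fun ω => f (X ω, Y ω) | mβ.comap X] =ᵐ[μ] fun ω => ∫ y, f (X ω, y) ∂ν (X ω) := by
  filter_upwards [condExp_prod_ae_eq_integral_condDistrib hX hY.aemeasurable hf hfi,
    condDistrib_ae_eq_of_condExp_charFun hX hY ν h] with ω h1 h2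
  rw [h1, h2]

theorem condExp_ae_eq_integral_prod_of_condExp_charFun [NormedAddCommGroup E]
    [InnerProductSpace ℝ E] [CompleteSpace E] [MeasurableSpace E] [BorelSpace E]
    [SecondCountableTopology E] {γ : Type*} [MeasurableSpace γ] [StandardBorelSpace γ] [Nonempty γ]
    {G : Type*} [NormedAddCommGroup G] [NormedSpace ℝ G] [CompleteSpace G] {Z : α → γ}
    (hX : Measurable X) (hY : Measurable Y) (hZ : Measurable Z)
    (ν : β → Measure E) [∀ b, IsProbabilityMeasure (ν b)]
    (h : ∀ u, μ[fun ω => Complex.exp ((inner ℝ (Y ω) u : ℝ) * Complex.I) | mβ.comap X]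
      =ᵐ[μ] fun ω => charFun (ν (X ω)) u)
    (hind : Indep (mβ.comap X ⊔ MeasurableSpace.comap Y inferInstance)
      (MeasurableSpace.comap Z inferInstance) μ)
    {f : β × E × γ → G} (hf : StronglyMeasurable f)
    (hfi : Integrable (fun ω => f (X ω, Y ω, Z ω)) μ) :
    μ[fun ω => f (X ω, Y ω, Z ω) | mβ.comap X]
      =ᵐ[μ] fun ω => ∫ p, f (X ω, p) ∂(ν (X ω)).prod (μ.map Z) := by
  filter_upwards [condExp_prod_ae_eq_integral_condDistrib hX (hY.prodMk hZ).aemeasurable hf hfi,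
    condDistrib_ae_eq_of_condExp_charFun hX hY ν h,
    condDistrib_prodMk_of_indep hX hY hZ hind] with ω h1 h2 h3
  rw [h1, h3, h2]

end CondLaw

/-! ### Measurable selection of maximizers -/

section Selection

theorem measurable_iSup_of_continuous {Ω T : Type*} [MeasurableSpace Ω] [TopologicalSpace T]
    [CompactSpace T] [TopologicalSpace.SeparableSpace T] [Nonempty T] {F : Ω → T → ℝ}
    (hm : ∀ x, Measurable fun ω => F ω x) (hc : ∀ ω, Continuous (F ω)) :
    Measurable fun ω => ⨆ x, F ω x := by
  refine measurable_of_Iic fun r => ?_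
  have : (fun ω => ⨆ x, F ω x) ⁻¹' Set.Iic r
      = ⋂ n, {ω | F ω (TopologicalSpace.denseSeq T n) ≤ r} := by
    ext ω
    simp only [Set.mem_preimage, Set.mem_Iic, Set.mem_iInter, Set.mem_ofPred_eq]
    rw [ciSup_le_iff (isCompact_range (hc ω)).bddAbove]
    refine ⟨fun h n => h _, fun h x => ?_⟩
    have hcl : IsClosed {x | F ω x ≤ r} := isClosed_le (hc ω) continuous_const
    have := hcl.closure_subset_iff.2 (Set.range_subset_iff.2 h)
    rw [(TopologicalSpace.denseRange_denseSeq T).closure_range] at this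
    exact this (Set.mem_univ x)
  rw [this]
  exact MeasurableSet.iInter fun n => measurableSet_le (hm _) measurable_const

/-- On a subset of the line one can select the least maximizer. It is at most `r` exactly when the
supremum over the points `≤ r` already reaches the full supremum, and both suprema are measurable.
-/
theorem exists_measurable_argmax_of_isCompact {Ω : Type*} [MeasurableSpace Ω] {T : Set ℝ}
    (hT : IsCompact T) (hne : T.Nonempty) {F : Ω → T → ℝ}
    (hm : ∀ x, Measurable fun ω => F ω x) (hc : ∀ ω, Continuous (F ω)) :
    ∃ α : Ω → T, Measurable α ∧ ∀ ω x, F ω x ≤ F ω (α ω) := by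
  have : CompactSpace T := isCompact_iff_compactSpace.1 hT
  have : Nonempty T := hne.to_subtype
  let S : Ω → Set T := fun ω => {x | ∀ y, F ω y ≤ F ω x}
  have hScl : ∀ ω, IsClosed (S ω) := fun ω => by
    simp only [S, Set.ofPred_forall]
    exact isClosed_iInter fun y => isClosed_le continuous_const (hc ω)
  have hSne : ∀ ω, (S ω).Nonempty := fun ω => by
    obtain ⟨x, -, hx⟩ := isCompact_univ.exists_isMaxOn Set.univ_nonempty (hc ω).continuousOn
    exact ⟨x, fun y => hx (Set.mem_univ y)⟩
  have hleast : ∀ ω, ∃ x : T, x ∈ S ω ∧ ∀ y ∈ S ω, (x : ℝ) ≤ y := fun ω => by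
    obtain ⟨x, hx, h⟩ := (hScl ω).isCompact.exists_isMinOn (hSne ω)
      continuous_subtype_val.continuousOn
    exact ⟨x, hx, h⟩
  choose α hα using hleast
  refine ⟨α, ?_, fun ω x => (hα ω).1 x⟩
  suffices Measurable fun ω => (α ω : ℝ) from this.subtype_mk
  refine measurable_of_Iic fun r => ?_
  let U : Set T := {x | (x : ℝ) ≤ r}
  have hU : IsClosed U := isClosed_le continuous_subtype_val continuous_const
  rcases U.eq_empty_or_nonempty with hUe | hUn
  · convert! MeasurableSet.empty
    ext ω
    exact iff_of_false (fun h => Set.eq_empty_iff_forall_notMem.1 hUe (α ω) h) fun h => h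
  have hUc : CompactSpace U := isCompact_iff_compactSpace.1 hU.isCompact
  have hUn' : Nonempty U := hUn.to_subtype
  have : (fun ω => (α ω : ℝ)) ⁻¹' Set.Iic r = {ω | ⨆ x, F ω x ≤ ⨆ x : U, F ω x} := by
    ext ω
    simp only [Set.mem_preimage, Set.mem_Iic, Set.mem_ofPred_eq]
    have hb := (isCompact_range (hc ω)).bddAbove
    have hcr : Continuous fun x : U => F ω x := (hc ω).comp continuous_subtype_val
    have hbr := (isCompact_range hcr).bddAbove
    constructor
    · intro h
      exact (ciSup_le fun x => (hα ω).1 x).trans (le_ciSup hbr ⟨α ω, h⟩)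
    · intro h
      obtain ⟨x, -, hx⟩ := isCompact_univ.exists_isMaxOn Set.univ_nonempty hcr.continuousOn
      refine ((hα ω).2 x fun y => ?_).trans x.2
      exact (le_ciSup hb y).trans (h.trans (ciSup_le fun z => hx (Set.mem_univ z)))
  rw [this]
  exact measurableSet_le (measurable_iSup_of_continuous hm hc)
    (measurable_iSup_of_continuous (fun x => hm _) fun ω => (hc ω).comp continuous_subtype_val)

/-- Measurable selection of a maximizer over a compact metric space. -/
theorem exists_measurable_argmax {Ω K : Type*} [MeasurableSpace Ω] [MetricSpace K] [CompactSpace K]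
    [Nonempty K] [MeasurableSpace K] [BorelSpace K] {f : Ω → K → ℝ}
    (hm : ∀ k, Measurable fun ω => f ω k) (hc : ∀ ω, Continuous (f ω)) :
    ∃ α : Ω → K, Measurable α ∧ ∀ ω k, f ω k ≤ f ω (α ω) := by
  -- Every nonempty compact metric space is a continuous image of the Cantor set, which reduces the
  -- problem to a compact subset of `ℝ`.
  obtain ⟨c, hcc, hcs⟩ := exists_nat_bool_continuous_surjective_of_compact K
  have hcont : Continuous (c ∘ cantorSetHomeomorphNatToBool) :=
    hcc.comp cantorSetHomeomorphNatToBool.continuous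
  obtain ⟨α, hα, hmax⟩ := exists_measurable_argmax_of_isCompact isCompact_cantorSet
    ⟨0, zero_mem_cantorSet⟩ (F := fun ω x => f ω (c (cantorSetHomeomorphNatToBool x)))
    (fun x => hm _) (fun ω => (hc ω).comp hcont)
  refine ⟨fun ω => c (cantorSetHomeomorphNatToBool (α ω)), hcont.measurable.comp hα, fun ω k => ?_⟩
  obtain ⟨b, rfl⟩ := hcs k
  simpa using hmax ω (cantorSetHomeomorphNatToBool.symm b)

end Selection

/-! ### Semidefinite forms and the posterior covariance -/

section QuadraticForm

variable {ι : Type*} [Fintype ι] {P : Matrix ι ι ℝ}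

theorem Matrix.PosSemidef.dotProduct_mulVec_comm (hP : P.PosSemidef) (x y : ι → ℝ) :
    x ⬝ᵥ P *ᵥ y = y ⬝ᵥ P *ᵥ x := by
  have h : Pᵀ = P := by simpa using hP.isHermitian.eq
  rw [dotProduct_mulVec, ← mulVec_transpose, h, dotProduct_comm]

/-- The quadratic polynomial `t ↦ (x + t y)ᵀ P (x + t y)` is nonnegative, so its discriminant is not
positive. -/
theorem Matrix.PosSemidef.sq_dotProduct_mulVec_le (hP : P.PosSemidef) (x y : ι → ℝ) :
    (x ⬝ᵥ P *ᵥ y) ^ 2 ≤ (x ⬝ᵥ P *ᵥ x) * (y ⬝ᵥ P *ᵥ y) := by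
  have h := discrim_le_zero (a := y ⬝ᵥ P *ᵥ y) (b := 2 * (x ⬝ᵥ P *ᵥ y)) (c := x ⬝ᵥ P *ᵥ x) fun t => by
    have h1 := hP.dotProduct_mulVec_nonneg (x + t • y)
    simp only [star_trivial, mulVec_add, mulVec_smul, dotProduct_add, add_dotProduct,
      dotProduct_smul, smul_dotProduct, smul_eq_mul] at h1
    rw [hP.dotProduct_mulVec_comm y x] at h1
    linarith
  rw [discrim] at h
  nlinarith

/-- Covariance of a Gaussian vector of covariance `P` given its noisy observation in direction `a`,
with noise variance `v`. -/
def posteriorCov (P : Matrix ι ι ℝ) (a : ι → ℝ) (v : ℝ) : Matrix ι ι ℝ :=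
  P - (a ⬝ᵥ (P *ᵥ a) + v)⁻¹ • (P * vecMulVec a a * P)

theorem dotProduct_posteriorCov_mulVec (P : Matrix ι ι ℝ) (a : ι → ℝ) (v : ℝ) (x y : ι → ℝ) :
    x ⬝ᵥ posteriorCov P a v *ᵥ y
      = x ⬝ᵥ P *ᵥ y - (a ⬝ᵥ (P *ᵥ a) + v)⁻¹ * (x ⬝ᵥ P *ᵥ a) * (a ⬝ᵥ P *ᵥ y) := by
  simp only [posteriorCov, sub_mulVec, dotProduct_sub, smul_mulVec, dotProduct_smul, smul_eq_mul,
    ← mulVec_mulVec, vecMulVec_mulVec, mulVec_smul, op_smul_eq_smul]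
  ring

theorem posSemidef_posteriorCov (hP : P.PosSemidef) (a : ι → ℝ) {v : ℝ} (hv : 0 < v) :
    (posteriorCov P a v).PosSemidef := by
  have hT : Pᵀ = P := by simpa using hP.isHermitian.eq
  refine PosSemidef.of_dotProduct_mulVec_nonneg ?_ fun x => ?_
  · rw [IsHermitian, conjTranspose_eq_transpose_of_trivial, posteriorCov]
    simp [hT, transpose_mul, Matrix.mul_assoc]
  · have ha : 0 ≤ a ⬝ᵥ (P *ᵥ a) := by simpa using hP.dotProduct_mulVec_nonneg a
    have hx : 0 ≤ x ⬝ᵥ (P *ᵥ x) := by simpa using hP.dotProduct_mulVec_nonneg x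
    have hS : 0 < a ⬝ᵥ (P *ᵥ a) + v := by linarith
    rw [star_trivial, dotProduct_posteriorCov_mulVec, hP.dotProduct_mulVec_comm a x,
      sub_nonneg, mul_assoc, ← sq, inv_mul_le_iff₀ hS]
    nlinarith [hP.sq_dotProduct_mulVec_le x a]

end QuadraticForm

/-! ### Conditioning a Gaussian vector on one noisy linear observation -/

section Gaussian

variable {d : ℕ} {P : Matrix (Fin d) (Fin d) ℝ}

theorem EuclideanSpace.inner_eq_dotProduct (x y : EuclideanSpace ℝ (Fin d)) :
    inner ℝ x y = x.ofLp ⬝ᵥ y.ofLp := by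
  rw [EuclideanSpace.inner_eq_star_dotProduct, star_trivial, dotProduct_comm]

/-- The Kalman gain of an observation in direction `a` with noise variance `v`. -/
def kalmanGain (P : Matrix (Fin d) (Fin d) ℝ) (a : EuclideanSpace ℝ (Fin d)) (v : ℝ) :
    EuclideanSpace ℝ (Fin d) :=
  (a.ofLp ⬝ᵥ (P *ᵥ a.ofLp) + v)⁻¹ • WithLp.toLp 2 (P *ᵥ a.ofLp)

theorem inner_kalmanGain (a u : EuclideanSpace ℝ (Fin d)) (v : ℝ) :
    inner ℝ (kalmanGain P a v) u
      = (a.ofLp ⬝ᵥ (P *ᵥ a.ofLp) + v)⁻¹ * (u.ofLp ⬝ᵥ P *ᵥ a.ofLp) := by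
  rw [kalmanGain, real_inner_smul_left, EuclideanSpace.inner_eq_dotProduct,
    dotProduct_comm _ u.ofLp]

variable (m a u : EuclideanSpace ℝ (Fin d)) (v : NNReal)

theorem integral_exp_prod_gaussian (hP : P.PosSemidef) (w : EuclideanSpace ℝ (Fin d)) (c : ℝ) :
    ∫ p : EuclideanSpace ℝ (Fin d) × ℝ, Complex.exp ((inner ℝ p.1 w + c * p.2 : ℝ) * Complex.I)
      ∂(multivariateGaussian m P).prod (gaussianReal 0 v)
    = Complex.exp ((inner ℝ w m : ℝ) * Complex.I
      - ((w.ofLp ⬝ᵥ P *ᵥ w.ofLp + c ^ 2 * v : ℝ) : ℂ) / 2) := by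
  have h1 : ∀ p : EuclideanSpace ℝ (Fin d) × ℝ,
      Complex.exp ((inner ℝ p.1 w + c * p.2 : ℝ) * Complex.I)
        = Complex.exp ((inner ℝ p.1 w : ℝ) * Complex.I) * Complex.exp (c * p.2 * Complex.I) := by
    intro p
    rw [← Complex.exp_add]
    push_cast
    ring_nf
  simp_rw [h1]
  rw [integral_prod_mul (fun x : EuclideanSpace ℝ (Fin d) =>
    Complex.exp ((inner ℝ x w : ℝ) * Complex.I)) (fun s : ℝ => Complex.exp (c * s * Complex.I)),
    ← charFun_apply, ← charFun_apply_real, charFun_multivariateGaussian hP, charFun_gaussianReal,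
    ← Complex.exp_add]
  push_cast
  ring_nf

theorem map_observation_prod_gaussian (hP : P.PosSemidef) :
    ((multivariateGaussian m P).prod (gaussianReal 0 v)).map (fun p => inner ℝ a p.1 + p.2)
      = gaussianReal (inner ℝ a m) (a.ofLp ⬝ᵥ (P *ᵥ a.ofLp) + v).toNNReal := by
  have ha : 0 ≤ a.ofLp ⬝ᵥ (P *ᵥ a.ofLp) := by simpa using hP.dotProduct_mulVec_nonneg a.ofLp
  have hme : Measurable fun p : EuclideanSpace ℝ (Fin d) × ℝ => inner ℝ a p.1 + p.2 := by fun_prop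
  have := Measure.isProbabilityMeasure_map
    (μ := (multivariateGaussian m P).prod (gaussianReal 0 v)) hme.aemeasurable
  apply Measure.ext_of_charFun
  ext t
  rw [charFun_apply_real, integral_map hme.aemeasurable
    (Measurable.aestronglyMeasurable (by fun_prop)), charFun_gaussianReal,
    Real.coe_toNNReal _ (by positivity)]
  have := integral_exp_prod_gaussian m v hP (t • a) t
  simp only [real_inner_smul_right, real_inner_smul_left] at this
  rw [show (fun p : EuclideanSpace ℝ (Fin d) × ℝ => Complex.exp (t * (inner ℝ a p.1 + p.2 : ℝ) *
    Complex.I)) = fun p => Complex.exp ((t * inner ℝ p.1 a + t * p.2 : ℝ) * Complex.I) by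
      ext p; rw [real_inner_comm]; push_cast; ring_nf, this]
  simp only [WithLp.ofLp_smul, mulVec_smul, dotProduct_smul, smul_dotProduct, smul_eq_mul]
  push_cast
  ring_nf

/-- The gain is chosen so that the residual has zero covariance with the observation. The cross term
then disappears from the joint characteristic function, which factors. -/
theorem indepFun_innovation (hP : P.PosSemidef) (hv : 0 < v) :
    IndepFun (fun p : EuclideanSpace ℝ (Fin d) × ℝ =>
        inner ℝ u p.1 - inner ℝ (kalmanGain P a v) u * (inner ℝ a p.1 + p.2))
      (fun p => inner ℝ a p.1 + p.2) ((multivariateGaussian m P).prod (gaussianReal 0 v)) ∧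
    ∫ p : EuclideanSpace ℝ (Fin d) × ℝ, Complex.exp
        ((inner ℝ u p.1 - inner ℝ (kalmanGain P a v) u * (inner ℝ a p.1 + p.2) : ℝ) * Complex.I)
        ∂(multivariateGaussian m P).prod (gaussianReal 0 v)
      = Complex.exp ((inner ℝ u m - inner ℝ (kalmanGain P a v) u * inner ℝ a m : ℝ) * Complex.I
        - ((u.ofLp ⬝ᵥ posteriorCov P a.ofLp v *ᵥ u.ofLp : ℝ) : ℂ) / 2) := by
  have ha : 0 ≤ a.ofLp ⬝ᵥ (P *ᵥ a.ofLp) := by simpa using hP.dotProduct_mulVec_nonneg a.ofLp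
  have hS : a.ofLp ⬝ᵥ (P *ᵥ a.ofLp) + v ≠ 0 := by positivity
  set S := a.ofLp ⬝ᵥ (P *ᵥ a.ofLp) + v with hSdef
  set k := inner ℝ (kalmanGain P a v) u with hk
  have hk' : k = S⁻¹ * (u.ofLp ⬝ᵥ P *ᵥ a.ofLp) := inner_kalmanGain a u v
  have huPa : u.ofLp ⬝ᵥ P *ᵥ a.ofLp = k * S := by rw [hk']; field_simp
  have haPu : a.ofLp ⬝ᵥ P *ᵥ u.ofLp = k * S := by rw [hP.dotProduct_mulVec_comm, huPa]
  have haPa : a.ofLp ⬝ᵥ P *ᵥ a.ofLp = S - v := by rw [hSdef]; ring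
  have hpost : u.ofLp ⬝ᵥ posteriorCov P a.ofLp v *ᵥ u.ofLp = u.ofLp ⬝ᵥ P *ᵥ u.ofLp - k ^ 2 * S := by
    rw [dotProduct_posteriorCov_mulVec, ← hSdef, huPa, haPu]
    field_simp
  -- Joint characteristic function of residual and observation at `(α, β)`; `(1, 0)` gives the
  -- second claim, and the values on the two axes give the marginals.
  have gen : ∀ α β : ℝ, ∫ p : EuclideanSpace ℝ (Fin d) × ℝ, Complex.exp
      ((α * (inner ℝ u p.1 - k * (inner ℝ a p.1 + p.2)) + β * (inner ℝ a p.1 + p.2) : ℝ)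
        * Complex.I) ∂(multivariateGaussian m P).prod (gaussianReal 0 v)
      = Complex.exp ((α * (inner ℝ u m - k * inner ℝ a m) + β * inner ℝ a m : ℝ) * Complex.I
        - ((α ^ 2 * (u.ofLp ⬝ᵥ posteriorCov P a.ofLp v *ᵥ u.ofLp) + β ^ 2 * S : ℝ) : ℂ) / 2) := by
    intro α β
    have h := integral_exp_prod_gaussian m v hP (α • u + (β - α * k) • a) (β - α * k)
    have e1 : ∀ p : EuclideanSpace ℝ (Fin d) × ℝ,
        inner ℝ p.1 (α • u + (β - α * k) • a) + (β - α * k) * p.2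
        = α * (inner ℝ u p.1 - k * (inner ℝ a p.1 + p.2)) + β * (inner ℝ a p.1 + p.2) := by
      intro p
      rw [inner_add_right, real_inner_smul_right, real_inner_smul_right, real_inner_comm,
        real_inner_comm a]
      ring
    simp_rw [e1] at h
    rw [h, inner_add_left, real_inner_smul_left, real_inner_smul_left]
    congr 2
    · congr 2
      ring
    · congr 2
      simp only [WithLp.ofLp_add, WithLp.ofLp_smul, mulVec_add, mulVec_smul, dotProduct_add,
        add_dotProduct, dotProduct_smul, smul_dotProduct, smul_eq_mul]
      rw [hpost, huPa, haPu, haPa]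
      ring
  have hU : Measurable fun p : EuclideanSpace ℝ (Fin d) × ℝ =>
      inner ℝ u p.1 - k * (inner ℝ a p.1 + p.2) := by fun_prop
  have hy : Measurable fun p : EuclideanSpace ℝ (Fin d) × ℝ => inner ℝ a p.1 + p.2 := by fun_prop
  refine ⟨?_, by simpa using gen 1 0⟩
  rw [indepFun_iff_charFun_prod hU.aemeasurable hy.aemeasurable]
  intro t
  rw [charFun_apply, integral_map (by fun_prop) (Measurable.aestronglyMeasurable (by fun_prop)),
    charFun_apply_real, integral_map (by fun_prop) (Measurable.aestronglyMeasurable (by fun_prop)),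
    charFun_apply_real, integral_map (by fun_prop) (Measurable.aestronglyMeasurable (by fun_prop))]
  have g1 := gen t.ofLp.1 t.ofLp.2
  have g2 := gen t.ofLp.1 0
  have g3 := gen 0 t.ofLp.2
  simp only [zero_mul, add_zero, zero_add, Complex.ofReal_mul] at g2 g3
  rw [g2, g3, ← Complex.exp_add]
  refine Eq.trans ?_ (g1.trans ?_)
  · refine integral_congr_ae (Filter.Eventually.of_forall fun p => ?_)
    simp [WithLp.prod_inner_apply]
  · push_cast
    ring_nf

/-- Write `⟨z, u⟩` as residual plus `k` times the observation: the exponential of the independent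
residual may be replaced by its mean. This is the defining identity of the conditional expectation
given the observation, for deterministic parameters. -/
theorem setIntegral_exp_observation (hP : P.PosSemidef) (hv : 0 < v) {B : Set ℝ}
    (hB : MeasurableSet B) :
    ∫ p : EuclideanSpace ℝ (Fin d) × ℝ, B.indicator (fun _ => (1 : ℂ)) (inner ℝ a p.1 + p.2)
        * Complex.exp ((inner ℝ p.1 u : ℝ) * Complex.I)
        ∂(multivariateGaussian m P).prod (gaussianReal 0 v)
    = ∫ p : EuclideanSpace ℝ (Fin d) × ℝ, B.indicator (fun _ => (1 : ℂ)) (inner ℝ a p.1 + p.2)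
        * charFun (multivariateGaussian (m + (inner ℝ a p.1 + p.2 - inner ℝ a m) • kalmanGain P a v)
          (posteriorCov P a.ofLp v)) u
        ∂(multivariateGaussian m P).prod (gaussianReal 0 v) := by
  obtain ⟨hind, hint⟩ := indepFun_innovation m a u v hP hv
  set k := inner ℝ (kalmanGain P a v) u with hk
  let g : ℝ → ℂ := fun y => B.indicator (fun _ => (1 : ℂ)) y * Complex.exp ((k * y : ℝ) * Complex.I)
  have hg : Measurable g := (measurable_const.indicator hB).mul (by fun_prop)
  have hmul := hind.integral_fun_comp_mul_comp
    (f := fun x : ℝ => Complex.exp ((x : ℂ) * Complex.I)) (g := g)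
    (Measurable.aemeasurable (by fun_prop)) (Measurable.aemeasurable (by fun_prop))
    (Measurable.aestronglyMeasurable (by fun_prop)) hg.aestronglyMeasurable
  rw [hint, ← integral_const_mul] at hmul
  convert! hmul using 2
  · ext p
    simp only [g]
    rw [mul_left_comm, ← Complex.exp_add, real_inner_comm u]
    push_cast
    ring_nf
  · ext p
    simp only [g]
    rw [charFun_multivariateGaussian (posSemidef_posteriorCov hP _ (by exact_mod_cast hv)),
      mul_left_comm, ← Complex.exp_add, inner_add_right, real_inner_smul_right,
      real_inner_comm (kalmanGain P a v), ← hk]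
    push_cast
    ring_nf

end Gaussian

/-! ### Measurable dependence of the filter on its data -/

section Measurability

variable {Ω : Type*} {mΩ : MeasurableSpace Ω} {d : ℕ} {P : Ω → Matrix (Fin d) (Fin d) ℝ}
  {a : Ω → EuclideanSpace ℝ (Fin d)}

theorem EuclideanSpace.measurable_of_apply {f : Ω → EuclideanSpace ℝ (Fin d)}
    (hf : ∀ i, Measurable fun ω => f ω i) : Measurable f :=
  (WithLp.measurable_toLp 2 _).comp (measurable_pi_iff.2 hf)

theorem measurable_mulVec_apply (hP : ∀ i j, Measurable fun ω => P ω i j) (ha : Measurable a)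
    (i : Fin d) : Measurable fun ω => (P ω *ᵥ (a ω).ofLp) i := by
  simp only [mulVec, dotProduct]
  fun_prop

theorem measurable_dotProduct_mulVec (hP : ∀ i j, Measurable fun ω => P ω i j) (ha : Measurable a)
    {b : Ω → EuclideanSpace ℝ (Fin d)} (hb : Measurable b) :
    Measurable fun ω => (b ω).ofLp ⬝ᵥ P ω *ᵥ (a ω).ofLp := by
  simp only [mulVec, dotProduct]
  fun_prop

theorem measurable_kalmanGain (hP : ∀ i j, Measurable fun ω => P ω i j) (ha : Measurable a)
    (v : ℝ) : Measurable fun ω => kalmanGain (P ω) (a ω) v := by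
  have h := measurable_dotProduct_mulVec hP ha ha
  refine EuclideanSpace.measurable_of_apply fun i => ?_
  simp only [kalmanGain, PiLp.smul_apply, smul_eq_mul]
  exact (h.add_const v).inv.mul (measurable_mulVec_apply hP ha i)

theorem measurable_posteriorCov (hP : ∀ i j, Measurable fun ω => P ω i j) (ha : Measurable a)
    (v : ℝ) (i j : Fin d) : Measurable fun ω => posteriorCov (P ω) (a ω).ofLp v i j := by
  have h := measurable_dotProduct_mulVec hP ha ha
  have h2 : Measurable fun ω => (P ω * vecMulVec (a ω).ofLp (a ω).ofLp * P ω) i j := by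
    simp only [Matrix.mul_apply, vecMulVec_apply]
    fun_prop
  simp only [posteriorCov, Matrix.sub_apply, Matrix.smul_apply, smul_eq_mul]
  exact (hP i j).sub ((h.add_const v).inv.mul h2)

theorem measurable_mul_mul_add_apply (hP : ∀ i j, Measurable fun ω => P ω i j)
    (A B C : Matrix (Fin d) (Fin d) ℝ) (i j : Fin d) :
    Measurable fun ω => (A * P ω * B + C) i j := by
  simp only [Matrix.add_apply, Matrix.mul_apply]
  fun_prop

theorem measurable_toLp_mulVec (A : Matrix (Fin d) (Fin d) ℝ) (ha : Measurable a) :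
    Measurable fun ω => WithLp.toLp 2 (A *ᵥ (a ω).ofLp) :=
  EuclideanSpace.measurable_of_apply fun i =>
    measurable_mulVec_apply (P := fun _ => A) (fun _ _ => measurable_const) ha i

end Measurability

/-! ### Conditionally Gaussian vectors and the Kalman filter -/

/-- Given the `σ`-algebra `F`, the random vector `z` is Gaussian with mean `m` and covariance `P`. -/
structure IsCondGaussian {Ω : Type*} {d : ℕ} (F : MeasurableSpace Ω) {mΩ : MeasurableSpace Ω}
    (μ : Measure Ω) (z m : Ω → EuclideanSpace ℝ (Fin d)) (P : Ω → Matrix (Fin d) (Fin d) ℝ) :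
    Prop where
  measurable_mean : Measurable[F] m
  measurable_cov : ∀ i j, Measurable[F] fun ω => P ω i j
  posSemidef : ∀ ω, (P ω).PosSemidef
  condExp_charFun : ∀ u, μ[fun ω => Complex.exp ((inner ℝ (z ω) u : ℝ) * Complex.I) | F]
    =ᵐ[μ] fun ω => charFun (multivariateGaussian (m ω) (P ω)) u

namespace IsCondGaussian

variable {Ω : Type*} {d : ℕ} {F F' mΩ : MeasurableSpace Ω}
  {μ : Measure Ω} [IsProbabilityMeasure μ] {z m : Ω → EuclideanSpace ℝ (Fin d)}
  {P : Ω → Matrix (Fin d) (Fin d) ℝ} {G : Type*} [NormedAddCommGroup G] [NormedSpace ℝ G]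
  [CompleteSpace G]

theorem condExp_eq_integral (h : IsCondGaussian F μ z m P) (hF : F ≤ mΩ) (hz : Measurable z)
    {f : Ω × EuclideanSpace ℝ (Fin d) → G} (hf : StronglyMeasurable[F.prod inferInstance] f)
    (hfi : Integrable (fun ω => f (ω, z ω)) μ) :
    μ[fun ω => f (ω, z ω) | F] =ᵐ[μ]
      fun ω => ∫ x, f (ω, x) ∂multivariateGaussian (m ω) (P ω) := by
  -- The conditioning variable is the identity into `Ω` equipped with `F`, so `f` may depend on `ω`
  -- in any `F`-measurable way; this freezes the random action.
  have := condExp_ae_eq_integral_of_condExp_charFun (mβ := F) (X := id) (Y := z)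
    (measurable_id'' hF) hz (fun ω => multivariateGaussian (m ω) (P ω))
    (by simpa [MeasurableSpace.comap_id] using h.condExp_charFun) hf hfi
  simpa [MeasurableSpace.comap_id] using this

theorem condExp_eq_integral_prod (h : IsCondGaussian F μ z m P) (hF : F ≤ mΩ) (hz : Measurable z)
    {γ : Type*} [MeasurableSpace γ] [StandardBorelSpace γ] [Nonempty γ] {Z : Ω → γ}
    (hZ : Measurable Z)
    (hind : Indep (F ⊔ MeasurableSpace.comap z inferInstance)
      (MeasurableSpace.comap Z inferInstance) μ)
    {f : Ω × EuclideanSpace ℝ (Fin d) × γ → G} (hf : StronglyMeasurable[F.prod inferInstance] f)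
    (hfi : Integrable (fun ω => f (ω, z ω, Z ω)) μ) :
    μ[fun ω => f (ω, z ω, Z ω) | F] =ᵐ[μ]
      fun ω => ∫ p, f (ω, p) ∂(multivariateGaussian (m ω) (P ω)).prod (μ.map Z) := by
  have := condExp_ae_eq_integral_prod_of_condExp_charFun (mβ := F) (X := id) (Y := z)
    (measurable_id'' hF) hz hZ (fun ω => multivariateGaussian (m ω) (P ω))
    (by simpa [MeasurableSpace.comap_id] using h.condExp_charFun)
    (by simpa [MeasurableSpace.comap_id] using hind) hf hfi
  simpa [MeasurableSpace.comap_id] using this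

/-- The prediction step of the Kalman filter. -/
theorem predict (h : IsCondGaussian F μ z m P) (hF : F ≤ mΩ) (hz : Measurable z)
    {ξ : Ω → EuclideanSpace ℝ (Fin d)} (hξ : Measurable ξ)
    (hind : Indep (F ⊔ MeasurableSpace.comap z inferInstance)
      (MeasurableSpace.comap ξ inferInstance) μ)
    (A : Matrix (Fin d) (Fin d) ℝ) {Q : Matrix (Fin d) (Fin d) ℝ} (hQ : Q.PosSemidef)
    (hlaw : μ.map ξ = multivariateGaussian 0 Q) :
    IsCondGaussian F μ (fun ω => WithLp.toLp 2 (A *ᵥ (z ω).ofLp) + ξ ω)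
      (fun ω => WithLp.toLp 2 (A *ᵥ (m ω).ofLp)) (fun ω => A * P ω * Aᵀ + Q) := by
  have hpsd : ∀ ω, (A * P ω * Aᵀ).PosSemidef := fun ω => by
    simpa using (h.posSemidef ω).mul_mul_conjTranspose_same A
  refine ⟨measurable_toLp_mulVec A h.measurable_mean,
    measurable_mul_mul_add_apply h.measurable_cov _ _ _, fun ω => (hpsd ω).add hQ, fun u => ?_⟩
  -- Moving `A` to the test vector splits the exponential into a factor of `z` and a factor of the
  -- independent noise.
  let u' : EuclideanSpace ℝ (Fin d) := WithLp.toLp 2 (Aᵀ *ᵥ u.ofLp)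
  have hu' : ∀ x : EuclideanSpace ℝ (Fin d),
      inner ℝ (WithLp.toLp 2 (A *ᵥ x.ofLp)) u = inner ℝ x u' := fun x => by
    simp only [EuclideanSpace.inner_eq_dotProduct, u']
    rw [dotProduct_mulVec, vecMul_transpose]
  let f : Ω × EuclideanSpace ℝ (Fin d) × EuclideanSpace ℝ (Fin d) → ℂ := fun p =>
    Complex.exp ((inner ℝ p.2.1 u' : ℝ) * Complex.I) * Complex.exp ((inner ℝ p.2.2 u : ℝ) * Complex.I)
  have hf' : StronglyMeasurable fun p : EuclideanSpace ℝ (Fin d) × EuclideanSpace ℝ (Fin d) =>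
    Complex.exp ((inner ℝ p.1 u' : ℝ) * Complex.I) * Complex.exp ((inner ℝ p.2 u : ℝ) * Complex.I) :=
      Measurable.stronglyMeasurable (by fun_prop)
  have hf : StronglyMeasurable[F.prod inferInstance] f :=
    hf'.comp_measurable measurable_snd
  have key := h.condExp_eq_integral_prod hF hz hξ hind hf
    (Integrable.of_bound (C := 1) (hf'.comp_measurable (hz.prodMk hξ)).aestronglyMeasurable
      (by filter_upwards with ω; simp only [f]; rw [norm_mul, Complex.norm_exp_ofReal_mul_I,
            Complex.norm_exp_ofReal_mul_I, one_mul]))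
  have e1 : (fun ω => Complex.exp
      ((inner ℝ (WithLp.toLp 2 (A *ᵥ (z ω).ofLp) + ξ ω) u : ℝ) * Complex.I))
      = fun ω => f (ω, z ω, ξ ω) := by
    ext ω
    simp only [f]
    rw [← Complex.exp_add, inner_add_left, hu']
    push_cast
    ring_nf
  rw [e1]
  filter_upwards [key] with ω hω
  rw [hω, hlaw]
  simp only [f]
  rw [integral_prod_mul (fun x : EuclideanSpace ℝ (Fin d) =>
    Complex.exp ((inner ℝ x u' : ℝ) * Complex.I))
    (fun x : EuclideanSpace ℝ (Fin d) => Complex.exp ((inner ℝ x u : ℝ) * Complex.I)),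
    ← charFun_apply, ← charFun_apply, charFun_multivariateGaussian (h.posSemidef ω),
    charFun_multivariateGaussian hQ, charFun_multivariateGaussian ((hpsd ω).add hQ),
    ← Complex.exp_add, real_inner_comm (WithLp.toLp 2 (A *ᵥ (m ω).ofLp)) u, hu', real_inner_comm u']
  have e2 : u.ofLp ⬝ᵥ (A * P ω * Aᵀ + Q) *ᵥ u.ofLp
      = u'.ofLp ⬝ᵥ P ω *ᵥ u'.ofLp + u.ofLp ⬝ᵥ Q *ᵥ u.ofLp := by
    simp only [u', add_mulVec, dotProduct_add, ← mulVec_mulVec]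
    rw [dotProduct_mulVec, ← mulVec_transpose]
  rw [e2]
  simp only [inner_zero_right]
  push_cast
  ring_nf

/-- The correction step of the Kalman filter. -/
theorem correct (h : IsCondGaussian F μ z m P) (hF : F ≤ mΩ) (hz : Measurable z)
    {η : Ω → ℝ} (hη : Measurable η)
    (hind : Indep (F ⊔ MeasurableSpace.comap z inferInstance)
      (MeasurableSpace.comap η inferInstance) μ)
    {v : NNReal} (hv : 0 < v) (hlaw : μ.map η = gaussianReal 0 v)
    {a : Ω → EuclideanSpace ℝ (Fin d)} (ha : Measurable[F] a)
    (hF'def : F' = F ⊔ MeasurableSpace.comap (fun ω => inner ℝ (a ω) (z ω) + η ω) inferInstance) :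
    IsCondGaussian F' μ z
      (fun ω => m ω + (inner ℝ (a ω) (z ω) + η ω - inner ℝ (a ω) (m ω)) •
        kalmanGain (P ω) (a ω) v)
      (fun ω => posteriorCov (P ω) (a ω).ofLp v) := by
  set X : Ω → ℝ := fun ω => inner ℝ (a ω) (z ω) + η ω with hX
  have hXm : Measurable X := ((ha.mono hF le_rfl).inner hz).add hη
  have hF' : F' ≤ mΩ := hF'def ▸ sup_le hF hXm.comap_le
  have hFF' : F ≤ F' := hF'def ▸ le_sup_left
  have hXF' : Measurable[F'] X := measurable_iff_comap_le.2 (hF'def ▸ le_sup_right)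
  have hm := h.measurable_mean
  have hK := measurable_kalmanGain h.measurable_cov ha v
  have hpost := measurable_posteriorCov h.measurable_cov ha v
  have ham : Measurable[F] fun ω => inner ℝ (a ω) (m ω) := Measurable.inner ha hm
  have hpsd : ∀ ω, (posteriorCov (P ω) (a ω).ofLp v).PosSemidef := fun ω =>
    posSemidef_posteriorCov (h.posSemidef ω) _ (by exact_mod_cast hv)
  have hm' : Measurable[F'] fun ω => m ω + (X ω - inner ℝ (a ω) (m ω)) •
      kalmanGain (P ω) (a ω) v :=
    (hm.mono hFF' le_rfl).add ((hXF'.sub (ham.mono hFF' le_rfl)).smul (hK.mono hFF' le_rfl))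
  refine ⟨hm', fun i j => (hpost i j).mono hFF' le_rfl, hpsd, fun u => ?_⟩
  have hq : Measurable[F] fun ω => u.ofLp ⬝ᵥ posteriorCov (P ω) (a ω).ofLp v *ᵥ u.ofLp :=
    measurable_dotProduct_mulVec (a := fun _ => u) (b := fun _ => u) hpost measurable_const
      measurable_const
  let c : Ω × ℝ → ℂ := fun p => charFun (multivariateGaussian
    (m p.1 + (p.2 - inner ℝ (a p.1) (m p.1)) • kalmanGain (P p.1) (a p.1) v)
    (posteriorCov (P p.1) (a p.1).ofLp v)) u
  have hc : Measurable[F.prod inferInstance] c := by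
    have e : c = fun p => Complex.exp ((inner ℝ u (m p.1 + (p.2 - inner ℝ (a p.1) (m p.1)) •
        kalmanGain (P p.1) (a p.1) v) : ℝ) * Complex.I
        - ((u.ofLp ⬝ᵥ posteriorCov (P p.1) (a p.1).ofLp v *ᵥ u.ofLp : ℝ) : ℂ) / 2) := by
      ext p
      simp only [c]
      rw [charFun_multivariateGaussian (hpsd _)]
    rw [e]
    have h1 := @measurable_fst Ω ℝ F inferInstance
    have h2 := @measurable_snd Ω ℝ F inferInstance
    have i1 := (hm.comp h1).add ((h2.sub (ham.comp h1)).smul (hK.comp h1))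
    have i2 := hq.comp h1
    simp only [Function.comp_def] at i1 i2
    exact Complex.measurable_exp.comp (((Complex.measurable_ofReal.comp
      (Measurable.inner measurable_const i1)).mul_const _).sub
        ((Complex.measurable_ofReal.comp i2).div_const _))
  have hcn : ∀ p, ‖c p‖ ≤ 1 := fun p => norm_charFun_le_one u
  have hpair : Measurable[F', F.prod inferInstance] fun ω => (ω, X ω) :=
    Measurable.prodMk (measurable_id'' hFF') hXF'
  have hcF' : Measurable[F'] fun ω => c (ω, X ω) := hc.comp hpair
  have he : Measurable fun ω => Complex.exp ((inner ℝ (z ω) u : ℝ) * Complex.I) := by fun_prop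
  have hei : Integrable (fun ω => Complex.exp ((inner ℝ (z ω) u : ℝ) * Complex.I)) μ :=
    Integrable.of_bound (C := 1) he.aestronglyMeasurable
      (by filter_upwards with ω; rw [Complex.norm_exp_ofReal_mul_I])
  have hci : Integrable (fun ω => c (ω, X ω)) μ :=
    Integrable.of_bound (C := 1) (hcF'.mono hF' le_rfl).aestronglyMeasurable
      (by filter_upwards with ω using hcn _)
  refine (ae_eq_condExp_of_forall_setIntegral_eq hF' hei (fun s _ _ => hci.integrableOn) ?_
    hcF'.stronglyMeasurable.aestronglyMeasurable).symm
  intro s hs _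
  -- Events of `F'` are exactly the preimages under `ω ↦ (ω, X ω)` of sets in the product of `F`
  -- with the Borel sets, so no π-system argument is needed.
  obtain ⟨S, hS, rfl⟩ : ∃ S, MeasurableSet[F.prod inferInstance] S ∧
      (fun ω => (ω, X ω)) ⁻¹' S = s := by
    have e : F' = MeasurableSpace.comap (fun ω => (ω, X ω)) (F.prod inferInstance) := by
      rw [MeasurableSpace.prod, MeasurableSpace.comap_sup, MeasurableSpace.comap_comp,
        MeasurableSpace.comap_comp]
      change F' = MeasurableSpace.comap id F ⊔ MeasurableSpace.comap X inferInstance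
      rw [MeasurableSpace.comap_id, hF'def]
    rw [e] at hs
    exact hs
  have hs' := hF' _ hs
  rw [← integral_indicator hs', ← integral_indicator hs']
  have hobs : Measurable[F.prod inferInstance, F.prod inferInstance]
      fun q : Ω × EuclideanSpace ℝ (Fin d) × ℝ => (q.1, inner ℝ (a q.1) q.2.1 + q.2.2) := by
    have h1 := @measurable_fst Ω (EuclideanSpace ℝ (Fin d) × ℝ) F inferInstance
    have h2 := @measurable_snd Ω (EuclideanSpace ℝ (Fin d) × ℝ) F inferInstance
    exact Measurable.prodMk h1 ((Measurable.inner (ha.comp h1) (measurable_fst.comp h2)).add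
      (measurable_snd.comp h2))
  let ind : Ω × ℝ → ℂ := S.indicator fun _ => 1
  have hind' : Measurable[F.prod inferInstance] ind := measurable_const.indicator hS
  have hindn : ∀ p, ‖ind p‖ ≤ 1 := fun p => by
    simp only [ind, Set.indicator]; split_ifs <;> simp
  let f₁ : Ω × EuclideanSpace ℝ (Fin d) × ℝ → ℂ := fun q =>
    ind (q.1, inner ℝ (a q.1) q.2.1 + q.2.2) * c (q.1, inner ℝ (a q.1) q.2.1 + q.2.2)
  let f₂ : Ω × EuclideanSpace ℝ (Fin d) × ℝ → ℂ := fun q =>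
    ind (q.1, inner ℝ (a q.1) q.2.1 + q.2.2) * Complex.exp ((inner ℝ q.2.1 u : ℝ) * Complex.I)
  have hf₁ : Measurable[F.prod inferInstance] f₁ := (hind'.comp hobs).mul (hc.comp hobs)
  have hf₂ : Measurable[F.prod inferInstance] f₂ := by
    have h2 := @measurable_snd Ω (EuclideanSpace ℝ (Fin d) × ℝ) F inferInstance
    have h3 : Measurable fun p : EuclideanSpace ℝ (Fin d) × ℝ =>
      Complex.exp ((inner ℝ p.1 u : ℝ) * Complex.I) := by fun_prop
    exact (hind'.comp hobs).mul (h3.comp h2)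
  have hall : Measurable[mΩ, F.prod inferInstance] fun ω => (ω, z ω, η ω) :=
    Measurable.prodMk (measurable_id'' hF) (hz.prodMk hη)
  have hf₁i : Integrable (fun ω => f₁ (ω, z ω, η ω)) μ :=
    Integrable.of_bound (C := 1) (hf₁.comp hall).aestronglyMeasurable (by
      filter_upwards with ω
      simp only [f₁, norm_mul]
      exact mul_le_one₀ (hindn _) (norm_nonneg _) (hcn _))
  have hf₂i : Integrable (fun ω => f₂ (ω, z ω, η ω)) μ :=
    Integrable.of_bound (C := 1) (hf₂.comp hall).aestronglyMeasurable (by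
      filter_upwards with ω
      simp only [f₂, norm_mul]
      rw [Complex.norm_exp_ofReal_mul_I, mul_one]
      exact hindn _)
  have k₁ := h.condExp_eq_integral_prod hF hz hη hind hf₁.stronglyMeasurable hf₁i
  have k₂ := h.condExp_eq_integral_prod hF hz hη hind hf₂.stronglyMeasurable hf₂i
  have e₁ : ((fun ω => (ω, X ω)) ⁻¹' S).indicator (fun ω => c (ω, X ω))
      = fun ω => f₁ (ω, z ω, η ω) := by
    ext ω
    by_cases hω : (ω, X ω) ∈ S
    · rw [Set.indicator_of_mem (show ω ∈ (fun ω => (ω, X ω)) ⁻¹' S from hω)]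
      simp [f₁, ind, Set.indicator_of_mem (show (ω, inner ℝ (a ω) (z ω) + η ω) ∈ S from hω), hX]
    · rw [Set.indicator_of_notMem (show ω ∉ (fun ω => (ω, X ω)) ⁻¹' S from hω)]
      simp [f₁, ind, Set.indicator_of_notMem (show (ω, inner ℝ (a ω) (z ω) + η ω) ∉ S from hω)]
  have e₂ : ((fun ω => (ω, X ω)) ⁻¹' S).indicator
      (fun ω => Complex.exp ((inner ℝ (z ω) u : ℝ) * Complex.I)) = fun ω => f₂ (ω, z ω, η ω) := by
    ext ω
    by_cases hω : (ω, X ω) ∈ S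
    · rw [Set.indicator_of_mem (show ω ∈ (fun ω => (ω, X ω)) ⁻¹' S from hω)]
      simp [f₂, ind, Set.indicator_of_mem (show (ω, inner ℝ (a ω) (z ω) + η ω) ∈ S from hω)]
    · rw [Set.indicator_of_notMem (show ω ∉ (fun ω => (ω, X ω)) ⁻¹' S from hω)]
      simp [f₂, ind, Set.indicator_of_notMem (show (ω, inner ℝ (a ω) (z ω) + η ω) ∉ S from hω)]
  refine Eq.trans (b := ∫ ω, f₁ (ω, z ω, η ω) ∂μ) ?_
    (Eq.trans (b := ∫ ω, f₂ (ω, z ω, η ω) ∂μ) ?_ ?_)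
  · exact congrArg (fun g => ∫ ω, g ω ∂μ) e₁
  -- After conditioning both sides on `F`, the parameters are deterministic for each `ω`, and the
  -- fixed-parameter identity applies with the section of `S` at `ω`.
  · rw [← integral_condExp hF, ← integral_condExp (f := fun ω => f₂ (ω, z ω, η ω)) hF]
    refine integral_congr_ae ?_
    filter_upwards [k₁, k₂] with ω h1 h2
    rw [h1, h2, hlaw]
    have hSω : MeasurableSet (Prod.mk ω ⁻¹' S) := (@measurable_prodMk_left Ω ℝ F _ ω) hS
    exact (setIntegral_exp_observation (m ω) (a ω) u v (h.posSemidef ω) hv hSω).symm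
  · exact congrArg (fun g => ∫ ω, g ω ∂μ) e₂.symm

end IsCondGaussian

/-! ### Gaussian moments and the expected norm of the next prediction -/

theorem memLp_multivariateGaussian {d : ℕ} (m : EuclideanSpace ℝ (Fin d))
    (P : Matrix (Fin d) (Fin d) ℝ) : MemLp id 2 (multivariateGaussian m P) :=
  IsGaussian.memLp_two_id

theorem memLp_apply_of_memLp {Ω : Type*} [MeasurableSpace Ω] {μ : Measure Ω} {d : ℕ}
    {f : Ω → EuclideanSpace ℝ (Fin d)} (hf : MemLp f 2 μ) (i : Fin d) :
    MemLp (fun ω => f ω i) 2 μ :=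
  hf.continuousLinearMap_comp (EuclideanSpace.proj (𝕜 := ℝ) i)

theorem integral_apply_multivariateGaussian {d : ℕ} (m : EuclideanSpace ℝ (Fin d))
    (P : Matrix (Fin d) (Fin d) ℝ) (i : Fin d) :
    ∫ x, x i ∂multivariateGaussian m P = m i := by
  have h := (EuclideanSpace.proj (𝕜 := ℝ) i).integral_comp_comm
    (μ := multivariateGaussian m P) (φ := id) IsGaussian.integrable_id
  simpa using! h

theorem integral_centered_mul_multivariateGaussian {d : ℕ} (m : EuclideanSpace ℝ (Fin d))
    {P : Matrix (Fin d) (Fin d) ℝ} (hP : P.PosSemidef) (i j : Fin d) :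
    ∫ x, (x i - m i) * (x j - m j) ∂multivariateGaussian m P = P i j := by
  rw [← covariance_eval_multivariateGaussian (μ := m) hP i j, covariance]
  simp_rw [integral_apply_multivariateGaussian]

theorem integral_norm_sq_multivariateGaussian {d : ℕ} (m : EuclideanSpace ℝ (Fin d))
    {P : Matrix (Fin d) (Fin d) ℝ} (hP : P.PosSemidef) :
    ∫ x, ‖x‖ ^ 2 ∂multivariateGaussian m P = ‖m‖ ^ 2 + P.trace := by
  have hi : ∀ i, MemLp (fun x : EuclideanSpace ℝ (Fin d) => x i) 2 (multivariateGaussian m P) :=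
    fun i => memLp_apply_of_memLp (memLp_multivariateGaussian m P) i
  simp_rw [EuclideanSpace.real_norm_sq_eq]
  rw [integral_finsetSum _ fun i _ => (hi i).integrable_sq, Matrix.trace, ← Finset.sum_add_distrib]
  refine Finset.sum_congr rfl fun i _ => ?_
  have h := variance_eq_sub (hi i)
  rw [variance_eval_multivariateGaussian hP, integral_apply_multivariateGaussian] at h
  simp only [Pi.pow_apply] at h
  rw [Matrix.diag_apply, h]
  ring

/-- The mean norm of `A (m + y K)`, where `K` is the Kalman gain and `y` the innovation of an
observation in direction `a`. -/
def meanPredictedNorm {d : ℕ} (A : Matrix (Fin d) (Fin d) ℝ) (v : ℝ)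
    (m : EuclideanSpace ℝ (Fin d)) (P : Matrix (Fin d) (Fin d) ℝ) (a : EuclideanSpace ℝ (Fin d)) :
    ℝ :=
  ∫ w, ‖Matrix.toEuclideanCLM (𝕜 := ℝ) A
    (m + (√(a.ofLp ⬝ᵥ P *ᵥ a.ofLp + v) * w) • kalmanGain P a v)‖ ∂gaussianReal 0 1

theorem measurable_meanPredictedNorm {Ω : Type*} {mΩ : MeasurableSpace Ω} {d : ℕ}
    (A : Matrix (Fin d) (Fin d) ℝ) (v : ℝ) {m a : Ω → EuclideanSpace ℝ (Fin d)}
    {P : Ω → Matrix (Fin d) (Fin d) ℝ} (hm : Measurable m)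
    (hP : ∀ i j, Measurable fun ω => P ω i j) (ha : Measurable a) :
    Measurable fun ω => meanPredictedNorm A v (m ω) (P ω) (a ω) := by
  have hK := measurable_kalmanGain hP ha v
  have hS := measurable_dotProduct_mulVec hP ha ha
  refine (StronglyMeasurable.integral_prod_right (f := fun ω w => ‖Matrix.toEuclideanCLM (𝕜 := ℝ) A
    (m ω + (√((a ω).ofLp ⬝ᵥ P ω *ᵥ (a ω).ofLp + v) * w) • kalmanGain (P ω) (a ω) v)‖) ?_).measurable
  refine Measurable.stronglyMeasurable ?_
  simp only [Function.uncurry_def]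
  have hfst := @measurable_fst Ω ℝ mΩ inferInstance
  have hS' := hS.comp hfst
  have hK' := hK.comp hfst
  have hm' := hm.comp hfst
  simp only [Function.comp_def] at hS' hK' hm'
  fun_prop

/-- Normalizing the innovation makes the integrating measure independent of the action. Dominated
convergence then applies, with a bound affine in `|w|` supplied by compactness of the sphere. -/
theorem continuous_meanPredictedNorm {d : ℕ} (A : Matrix (Fin d) (Fin d) ℝ) {v : ℝ} (hv : 0 < v)
    (m : EuclideanSpace ℝ (Fin d)) {P : Matrix (Fin d) (Fin d) ℝ} (hP : P.PosSemidef) :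
    Continuous fun b : Metric.sphere (0 : EuclideanSpace ℝ (Fin d)) 1 =>
      meanPredictedNorm A v m P b := by
  have hPa : Continuous fun a : EuclideanSpace ℝ (Fin d) => P *ᵥ a.ofLp :=
    Continuous.matrix_mulVec continuous_const (PiLp.continuous_ofLp 2 _)
  have hS : Continuous fun a : EuclideanSpace ℝ (Fin d) => a.ofLp ⬝ᵥ P *ᵥ a.ofLp + v :=
    ((PiLp.continuous_ofLp 2 _).dotProduct hPa).add_const v
  have hS0 : ∀ a : EuclideanSpace ℝ (Fin d), a.ofLp ⬝ᵥ P *ᵥ a.ofLp + v ≠ 0 := fun a => by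
    have : 0 ≤ a.ofLp ⬝ᵥ (P *ᵥ a.ofLp) := by simpa using hP.dotProduct_mulVec_nonneg a.ofLp
    positivity
  have hK : Continuous fun a : EuclideanSpace ℝ (Fin d) => kalmanGain P a v :=
    (hS.inv₀ hS0).smul ((PiLp.continuous_toLp 2 _).comp hPa)
  have hc : Continuous fun b : Metric.sphere (0 : EuclideanSpace ℝ (Fin d)) 1 =>
      √((b : EuclideanSpace ℝ (Fin d)).ofLp ⬝ᵥ P *ᵥ (b : EuclideanSpace ℝ (Fin d)).ofLp + v)
        • kalmanGain P b v :=
    (hS.sqrt.smul hK).comp continuous_subtype_val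
  obtain ⟨C, hC⟩ := isCompact_univ.exists_bound_of_continuousOn hc.continuousOn
  simp only [meanPredictedNorm]
  refine continuous_of_dominated (bound := fun w => ‖Matrix.toEuclideanCLM (𝕜 := ℝ) A‖ *
    (‖m‖ + |w| * C)) ?_ ?_ ?_ ?_
  · intro b
    exact Measurable.aestronglyMeasurable (by fun_prop)
  · intro b
    filter_upwards with w
    rw [norm_norm]
    refine (ContinuousLinearMap.le_opNorm _ _).trans ?_
    gcongr
    refine (norm_add_le _ _).trans ?_
    gcongr
    rw [mul_comm, mul_smul, norm_smul, Real.norm_eq_abs]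
    gcongr
    exact hC b (Set.mem_univ b)
  · have h : Integrable (fun w : ℝ => |w|) (gaussianReal 0 1) :=
      (IsGaussian.integrable_id (μ := gaussianReal 0 1)).abs
    exact ((integrable_const _).add (h.mul_const C)).const_mul _
  · filter_upwards with w
    have h1 := (hS.comp (continuous_subtype_val
      (p := fun x => x ∈ Metric.sphere (0 : EuclideanSpace ℝ (Fin d)) 1))).sqrt
    have h2 := hK.comp (continuous_subtype_val
      (p := fun x => x ∈ Metric.sphere (0 : EuclideanSpace ℝ (Fin d)) 1))
    exact ((Matrix.toEuclideanCLM (𝕜 := ℝ) A).continuous.comp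
      (continuous_const.add ((h1.mul continuous_const).smul h2))).norm

theorem integral_norm_innovation {d : ℕ} (A : Matrix (Fin d) (Fin d) ℝ) (v : NNReal)
    (m a : EuclideanSpace ℝ (Fin d)) {P : Matrix (Fin d) (Fin d) ℝ} (hP : P.PosSemidef) :
    ∫ p : EuclideanSpace ℝ (Fin d) × ℝ, ‖Matrix.toEuclideanCLM (𝕜 := ℝ) A
      (m + (inner ℝ a p.1 + p.2 - inner ℝ a m) • kalmanGain P a v)‖
        ∂(multivariateGaussian m P).prod (gaussianReal 0 v)
      = meanPredictedNorm A v m P a := by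
  have ha : 0 ≤ a.ofLp ⬝ᵥ (P *ᵥ a.ofLp) := by simpa using hP.dotProduct_mulVec_nonneg a.ofLp
  have hlaw : gaussianReal (inner ℝ a m) (a.ofLp ⬝ᵥ (P *ᵥ a.ofLp) + v).toNNReal
      = (gaussianReal 0 1).map fun w => √(a.ofLp ⬝ᵥ P *ᵥ a.ofLp + v) * w + inner ℝ a m := by
    have h1 : (fun w => √(a.ofLp ⬝ᵥ P *ᵥ a.ofLp + v) * w + inner ℝ a m)
      = (· + inner ℝ a m) ∘ (√(a.ofLp ⬝ᵥ P *ᵥ a.ofLp + v) * ·) := rfl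
    rw [h1, ← Measure.map_map (by fun_prop) (by fun_prop), gaussianReal_map_const_mul,
      gaussianReal_map_add_const]
    congr 1
    · ring
    · ext
      rw [Real.coe_toNNReal _ (by positivity)]
      simp [Real.sq_sqrt (show 0 ≤ a.ofLp ⬝ᵥ P *ᵥ a.ofLp + (v : ℝ) by positivity)]
  have h2 := integral_map (μ := (multivariateGaussian m P).prod (gaussianReal 0 v))
    (φ := fun p : EuclideanSpace ℝ (Fin d) × ℝ => inner ℝ a p.1 + p.2)
    (f := fun y => ‖Matrix.toEuclideanCLM (𝕜 := ℝ) A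
      (m + (y - inner ℝ a m) • kalmanGain P a v)‖)
    (Measurable.aemeasurable (by fun_prop)) (Measurable.aestronglyMeasurable (by fun_prop))
  rw [← h2, map_observation_prod_gaussian m a v hP, hlaw, integral_map
    (Measurable.aemeasurable (by fun_prop)) (Measurable.aestronglyMeasurable (by fun_prop))]
  simp only [add_sub_cancel_right, meanPredictedNorm]

namespace IsCondGaussian

variable {Ω : Type*} {d : ℕ} {F mΩ : MeasurableSpace Ω}
  {μ : Measure Ω} [IsProbabilityMeasure μ] {z m : Ω → EuclideanSpace ℝ (Fin d)}
  {P : Ω → Matrix (Fin d) (Fin d) ℝ}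

theorem condExp_eq (h : IsCondGaussian F μ z m P) (hF : F ≤ mΩ) (hz : Measurable z)
    (hzi : Integrable z μ) : μ[z | F] =ᵐ[μ] m := by
  have := h.condExp_eq_integral hF hz (f := fun p => p.2)
    (measurable_snd.stronglyMeasurable) hzi
  simpa using this

theorem memLp_mean (h : IsCondGaussian F μ z m P) (hF : F ≤ mΩ) (hz : Measurable z)
    (hz2 : MemLp z 2 μ) : MemLp m 2 μ :=
  (memLp_congr_ae (h.condExp_eq hF hz (hz2.integrable one_le_two))).1 (hz2.condExp one_le_two)

theorem condExp_centered_mul (h : IsCondGaussian F μ z m P) (hF : F ≤ mΩ) (hz : Measurable z)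
    (hz2 : MemLp z 2 μ) (i j : Fin d) :
    μ[fun ω => (z ω - m ω) i * (z ω - m ω) j | F] =ᵐ[μ] fun ω => P ω i j := by
  have hm := h.measurable_mean
  have h1 := @measurable_fst Ω (EuclideanSpace ℝ (Fin d)) F inferInstance
  have h2 := @measurable_snd Ω (EuclideanSpace ℝ (Fin d)) F inferInstance
  have hap : ∀ k : Fin d, Measurable fun x : EuclideanSpace ℝ (Fin d) => x k := fun k => by fun_prop
  have hmeas : ∀ k, Measurable[F.prod inferInstance]
      fun p : Ω × EuclideanSpace ℝ (Fin d) => (p.2 - m p.1) k := fun k =>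
    (hap k).comp (h2.sub (hm.comp h1))
  have hL : MemLp (fun ω => z ω - m ω) 2 μ := hz2.sub (h.memLp_mean hF hz hz2)
  have key := h.condExp_eq_integral hF hz
    (f := fun p => (p.2 - m p.1) i * (p.2 - m p.1) j)
    ((hmeas i).mul (hmeas j)).stronglyMeasurable
    ((memLp_apply_of_memLp hL i).integrable_mul (memLp_apply_of_memLp hL j))
  filter_upwards [key] with ω hω
  rw [hω, ← integral_centered_mul_multivariateGaussian (m ω) (h.posSemidef ω) i j]
  simp

theorem condExp_norm_sq (h : IsCondGaussian F μ z m P) (hF : F ≤ mΩ) (hz : Measurable z)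
    (hz2 : MemLp z 2 μ) :
    μ[fun ω => ‖z ω‖ ^ 2 | F] =ᵐ[μ] fun ω => ‖m ω‖ ^ 2 + (P ω).trace := by
  have hmeas : Measurable fun x : EuclideanSpace ℝ (Fin d) => ‖x‖ ^ 2 := by fun_prop
  have key := h.condExp_eq_integral hF hz (f := fun p => ‖p.2‖ ^ 2)
    (hmeas.comp (@measurable_snd Ω (EuclideanSpace ℝ (Fin d)) F inferInstance)).stronglyMeasurable
    hz2.norm.integrable_sq
  filter_upwards [key] with ω hω
  rw [hω, integral_norm_sq_multivariateGaussian _ (h.posSemidef ω)]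

theorem condExp_norm_innovation (h : IsCondGaussian F μ z m P) (hF : F ≤ mΩ) (hz : Measurable z)
    {η : Ω → ℝ} (hη : Measurable η)
    (hind : Indep (F ⊔ MeasurableSpace.comap z inferInstance)
      (MeasurableSpace.comap η inferInstance) μ)
    {v : NNReal} (hlaw : μ.map η = gaussianReal 0 v)
    {a : Ω → EuclideanSpace ℝ (Fin d)} (ha : Measurable[F] a) (A : Matrix (Fin d) (Fin d) ℝ)
    (hint : Integrable (fun ω => ‖Matrix.toEuclideanCLM (𝕜 := ℝ) A (m ω +
      (inner ℝ (a ω) (z ω) + η ω - inner ℝ (a ω) (m ω)) • kalmanGain (P ω) (a ω) v)‖) μ) :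
    μ[fun ω => ‖Matrix.toEuclideanCLM (𝕜 := ℝ) A (m ω +
      (inner ℝ (a ω) (z ω) + η ω - inner ℝ (a ω) (m ω)) • kalmanGain (P ω) (a ω) v)‖ | F]
      =ᵐ[μ] fun ω => meanPredictedNorm A v (m ω) (P ω) (a ω) := by
  have hm := h.measurable_mean
  have hK := measurable_kalmanGain h.measurable_cov ha v
  have h1 := @measurable_fst Ω (EuclideanSpace ℝ (Fin d) × ℝ) F inferInstance
  have h2 := @measurable_snd Ω (EuclideanSpace ℝ (Fin d) × ℝ) F inferInstance
  have hX : Measurable[F.prod inferInstance] fun q : Ω × EuclideanSpace ℝ (Fin d) × ℝ =>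
      m q.1 + (inner ℝ (a q.1) q.2.1 + q.2.2 - inner ℝ (a q.1) (m q.1)) •
        kalmanGain (P q.1) (a q.1) v :=
    (hm.comp h1).add ((((Measurable.inner (ha.comp h1) (measurable_fst.comp h2)).add
      (measurable_snd.comp h2)).sub (Measurable.inner (ha.comp h1) (hm.comp h1))).smul
        (hK.comp h1))
  have hf : Measurable[F.prod inferInstance] fun q : Ω × EuclideanSpace ℝ (Fin d) × ℝ =>
      ‖Matrix.toEuclideanCLM (𝕜 := ℝ) A (m q.1 + (inner ℝ (a q.1) q.2.1 + q.2.2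
        - inner ℝ (a q.1) (m q.1)) • kalmanGain (P q.1) (a q.1) v)‖ := measurable_norm.comp
    ((Matrix.toEuclideanCLM (𝕜 := ℝ) A).continuous.measurable.comp hX)
  have key := h.condExp_eq_integral_prod hF hz hη hind hf.stronglyMeasurable hint
  filter_upwards [key] with ω hω
  rw [hω, hlaw, integral_norm_innovation A v _ _ (h.posSemidef ω)]

end IsCondGaussian

/-- The Riccati update is a correction followed by a prediction; in this form it visibly dominates
`Q`. -/
theorem LGDS.g_eq {d : ℕ} (M : LGDS d) (P : Matrix (Fin d) (Fin d) ℝ)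
    (a : EuclideanSpace ℝ (Fin d)) :
    M.g P a = M.Γ * posteriorCov P a.ofLp (M.σ ^ 2) * M.Γᵀ + M.Q := by
  rw [LGDS.g, posteriorCov, Matrix.mul_sub, Matrix.sub_mul, Matrix.mul_smul, Matrix.smul_mul]
  simp only [Matrix.mul_assoc]
  abel

/-! ### The observation filtration and the filter along an admissible policy -/

namespace LGDS.Realization

variable {d : ℕ} {M : LGDS d} {Ω : Type*} [MeasurableSpace Ω] {μ : Measure Ω}
  (R : M.Realization μ)

/-- The `σ`-algebras generated by the primitive random variables. -/
@[reducible]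
def noise (i : Unit ⊕ ℕ ⊕ ℕ) : MeasurableSpace Ω :=
  Sum.elim (fun _ => MeasurableSpace.comap R.z₀ inferInstance)
    (Sum.elim (fun t => MeasurableSpace.comap (R.ξ t) inferInstance)
      (fun t => MeasurableSpace.comap (R.η t) inferInstance)) i

theorem noise_le (i : Unit ⊕ ℕ ⊕ ℕ) : R.noise i ≤ (inferInstance : MeasurableSpace Ω) := by
  rcases i with _ | t | t
  · exact R.measurable_z₀.comap_le
  · exact (R.measurable_ξ t).comap_le
  · exact (R.measurable_η t).comap_le

/-- The indices of the primitive random variables that occur before time `t`. -/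
def indicesBefore (t : ℕ) : Set (Unit ⊕ ℕ ⊕ ℕ) :=
  {i | Sum.elim (fun _ => True) (Sum.elim (· < t) (· < t)) i}

theorem indicesBefore_mono {s t : ℕ} (h : s ≤ t) : indicesBefore s ⊆ indicesBefore t := by
  rintro (_ | r | r) hr
  · trivial
  · exact lt_of_lt_of_le hr h
  · exact lt_of_lt_of_le hr h

/-- The `σ`-algebra generated by the primitive random variables with index in `S`. -/
@[reducible]
def noiseOn (S : Set (Unit ⊕ ℕ ⊕ ℕ)) : MeasurableSpace Ω := ⨆ i ∈ S, R.noise i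

theorem noiseOn_mono {S T : Set (Unit ⊕ ℕ ⊕ ℕ)} (h : S ⊆ T) : R.noiseOn S ≤ R.noiseOn T :=
  biSup_mono h

theorem noise_le_noiseOn {S : Set (Unit ⊕ ℕ ⊕ ℕ)} {i : Unit ⊕ ℕ ⊕ ℕ} (h : i ∈ S) :
    R.noise i ≤ R.noiseOn S :=
  le_biSup R.noise h

theorem noiseOn_le (S : Set (Unit ⊕ ℕ ⊕ ℕ)) :
    R.noiseOn S ≤ (inferInstance : MeasurableSpace Ω) :=
  iSup₂_le fun i _ => R.noise_le i

theorem measurable_state_noiseOn (t : ℕ) : Measurable[R.noiseOn (indicesBefore t)] (R.state t) := by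
  induction t with
  | zero =>
    exact measurable_iff_comap_le.2 (R.noise_le_noiseOn (i := Sum.inl ()) trivial)
  | succ t ih =>
    refine (measurable_toLp_mulVec M.Γ
      (ih.mono (R.noiseOn_mono (indicesBefore_mono t.le_succ)) le_rfl)).add ?_
    exact measurable_iff_comap_le.2
      (R.noise_le_noiseOn (i := Sum.inr (Sum.inl t)) (Nat.lt_succ_self t))

theorem measurable_state (t : ℕ) : Measurable (R.state t) :=
  (R.measurable_state_noiseOn t).mono (R.noiseOn_le _) le_rfl

theorem memLp_state (t : ℕ) : MemLp (R.state t) 2 μ := by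
  have hgauss : ∀ {f : Ω → EuclideanSpace ℝ (Fin d)} {S : Matrix (Fin d) (Fin d) ℝ},
      Measurable f → μ.map f = multivariateGaussian 0 S → MemLp f 2 μ := by
    intro f S hf h
    have := memLp_multivariateGaussian 0 S
    rw [← h, memLp_map_measure_iff aestronglyMeasurable_id hf.aemeasurable] at this
    exact this
  induction t with
  | zero => exact hgauss R.measurable_z₀ R.law_z₀
  | succ t ih =>
    exact (ih.continuousLinearMap_comp (Matrix.toEuclideanCLM (𝕜 := ℝ) M.Γ)).add
      (hgauss (R.measurable_ξ t) (R.law_ξ t))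

variable {R} {a : ℕ → Ω → EuclideanSpace ℝ (Fin d)}

theorem past_zero : R.past a 0 = ⊥ := iSup_of_empty _

theorem past_succ (t : ℕ) :
    R.past a (t + 1) = R.past a t ⊔ MeasurableSpace.comap (R.reward a t) inferInstance := by
  refine le_antisymm (iSup_le fun s => ?_) (sup_le (iSup_le fun s => ?_) ?_)
  · rcases Nat.lt_succ_iff_lt_or_eq.1 s.2 with h | h
    · exact le_sup_of_le_left (le_iSup (fun s : Fin t =>
        MeasurableSpace.comap (R.reward a s) inferInstance) ⟨s, h⟩)
    · rw [h]
      exact le_sup_right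
  · exact le_iSup (fun s : Fin (t + 1) =>
      MeasurableSpace.comap (R.reward a s) inferInstance) s.castSucc
  · exact le_iSup (fun s : Fin (t + 1) =>
      MeasurableSpace.comap (R.reward a s) inferInstance) (Fin.last t)

theorem past_congr {b : ℕ → Ω → EuclideanSpace ℝ (Fin d)} {t : ℕ} (h : ∀ s < t, a s = b s) :
    R.past a t = R.past b t := by
  refine iSup_congr fun s => ?_
  congr 1
  ext ω
  rw [reward, reward, h s s.2]

theorem AdmissibleBefore.mono {s t : ℕ} (h : R.AdmissibleBefore t a) (hst : s ≤ t) :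
    R.AdmissibleBefore s a :=
  fun r hr => h r (hr.trans_le hst)

/-- Admissibility closes the loop inductively: each action depends only on earlier rewards, hence so
far only on earlier noise. -/
theorem past_le_noiseOn {t : ℕ} (h : R.AdmissibleBefore t a) :
    R.past a t ≤ R.noiseOn (indicesBefore t) := by
  induction t with
  | zero => rw [past_zero]; exact bot_le
  | succ t ih =>
    have ih' := ih (h.mono t.le_succ)
    rw [past_succ]
    have hle := R.noiseOn_mono (indicesBefore_mono t.le_succ)
    refine sup_le (ih'.trans hle) (measurable_iff_comap_le.1 ?_)
    exact (Measurable.inner (((h t t.lt_succ_self).1.mono ih' le_rfl).mono hle le_rfl)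
      ((R.measurable_state_noiseOn t).mono hle le_rfl)).add (measurable_iff_comap_le.2
        (R.noise_le_noiseOn (i := Sum.inr (Sum.inr t)) (Nat.lt_succ_self t)))

theorem past_le {t : ℕ} (h : R.AdmissibleBefore t a) :
    R.past a t ≤ (inferInstance : MeasurableSpace Ω) :=
  (past_le_noiseOn h).trans (R.noiseOn_le _)

theorem indep_η {t : ℕ} (h : R.AdmissibleBefore t a) :
    Indep (R.past a t ⊔ MeasurableSpace.comap (R.state t) inferInstance)
      (MeasurableSpace.comap (R.η t) inferInstance) μ := by
  have hd : Disjoint (indicesBefore t) {Sum.inr (Sum.inr t)} := by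
    rw [Set.disjoint_singleton_right]
    exact lt_irrefl t
  have := indep_iSup_of_disjoint R.noise_le R.indep hd
  refine indep_of_indep_of_le_right (indep_of_indep_of_le_left this ?_) ?_
  · exact sup_le (past_le_noiseOn h) (R.measurable_state_noiseOn t).comap_le
  · exact R.noise_le_noiseOn (i := Sum.inr (Sum.inr t)) rfl

theorem indep_ξ {t : ℕ} (h : R.AdmissibleBefore (t + 1) a) :
    Indep (R.past a (t + 1) ⊔ MeasurableSpace.comap (R.state t) inferInstance)
      (MeasurableSpace.comap (R.ξ t) inferInstance) μ := by
  -- The past at time `t + 1` involves `η t` but not yet `ξ t`, so `indicesBefore (t + 1)` would be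
  -- too large here.
  have hd : Disjoint (indicesBefore t ∪ {Sum.inr (Sum.inr t)}) {Sum.inr (Sum.inl t)} := by
    rw [Set.disjoint_singleton_right]
    rintro (h | h)
    · exact lt_irrefl t h
    · simp at h
  have := indep_iSup_of_disjoint R.noise_le R.indep hd
  refine indep_of_indep_of_le_right (indep_of_indep_of_le_left this ?_) ?_
  · have hle := R.noiseOn_mono (Set.subset_union_left
      (s := indicesBefore t) (t := {Sum.inr (Sum.inr t)}))
    have hp := past_le_noiseOn (h.mono t.le_succ)
    rw [past_succ]
    refine sup_le (sup_le (hp.trans hle) (measurable_iff_comap_le.1 ?_))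
      ((R.measurable_state_noiseOn t).comap_le.trans hle)
    exact (Measurable.inner (((h t t.lt_succ_self).1.mono hp le_rfl).mono hle le_rfl)
      ((R.measurable_state_noiseOn t).mono hle le_rfl)).add (measurable_iff_comap_le.2
        (R.noise_le_noiseOn (i := Sum.inr (Sum.inr t)) (Or.inr rfl)))
  · exact R.noise_le_noiseOn (i := Sum.inr (Sum.inl t)) rfl

variable [IsProbabilityMeasure μ]

/-- One step of the Kalman filter. -/
theorem isCondGaussian_succ {t : ℕ} (h : R.AdmissibleBefore (t + 1) a)
    {m : Ω → EuclideanSpace ℝ (Fin d)} {P : Ω → Matrix (Fin d) (Fin d) ℝ}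
    (hg : IsCondGaussian (R.past a t) μ (R.state t) m P) :
    IsCondGaussian (R.past a (t + 1)) μ (R.state (t + 1))
      (fun ω => Matrix.toEuclideanCLM (𝕜 := ℝ) M.Γ (m ω +
        (inner ℝ (a t ω) (R.state t ω) + R.η t ω - inner ℝ (a t ω) (m ω)) •
          kalmanGain (P ω) (a t ω) (M.σ ^ 2).toNNReal))
      (fun ω => M.g (P ω) (a t ω)) := by
  have ht := h.mono t.le_succ
  have hv : 0 < (M.σ ^ 2).toNNReal := Real.toNNReal_pos.2 (pow_pos M.σ_pos 2)
  have h1 := hg.correct (past_le ht) (R.measurable_state t) (R.measurable_η t) (indep_η ht) hv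
    (R.law_η t) (h t t.lt_succ_self).1 (past_succ t)
  have h2 := h1.predict (past_le h) (R.measurable_state t) (R.measurable_ξ t) (indep_ξ h) M.Γ
    M.Q_psd (R.law_ξ t)
  simp only [LGDS.g_eq]
  rw [Real.coe_toNNReal _ (sq_nonneg M.σ)] at h2 ⊢
  exact h2

theorem isCondGaussian_zero : IsCondGaussian (R.past a 0) μ (R.state 0) 0 fun _ => M.S₀ := by
  refine ⟨measurable_const, fun _ _ => measurable_const, fun _ => M.S₀_psd, fun u => ?_⟩
  rw [past_zero, condExp_bot]
  refine Filter.Eventually.of_forall fun ω => ?_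
  simp only [Pi.zero_apply]
  rw [← R.law_z₀, charFun_apply, integral_map R.measurable_z₀.aemeasurable
    (Measurable.aestronglyMeasurable (by fun_prop))]
  rfl

/-- The bound `P ≥ Q` is recorded for the controllability argument. It needs one transition: at time
`0` the covariance is `S₀`, which is unrelated to `Q`. -/
theorem exists_isCondGaussian {t : ℕ} (h : R.AdmissibleBefore t a) :
    ∃ m P, IsCondGaussian (R.past a t) μ (R.state t) m P ∧
      (t ≠ 0 → ∀ ω, (P ω - M.Q).PosSemidef) := by
  induction t with
  | zero => exact ⟨_, _, isCondGaussian_zero, fun h => absurd rfl h⟩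
  | succ t ih =>
    obtain ⟨m, P, hg, -⟩ := ih (h.mono t.le_succ)
    refine ⟨_, _, isCondGaussian_succ h hg, fun _ ω => ?_⟩
    rw [LGDS.g_eq, add_sub_cancel_right]
    simpa using (posSemidef_posteriorCov (hg.posSemidef ω) (a t ω).ofLp
      (pow_pos M.σ_pos 2)).mul_mul_conjTranspose_same M.Γ

section Moments

variable {t : ℕ} {m : Ω → EuclideanSpace ℝ (Fin d)} {P : Ω → Matrix (Fin d) (Fin d) ℝ}

theorem pred_ae_eq (h : R.AdmissibleBefore t a)
    (hg : IsCondGaussian (R.past a t) μ (R.state t) m P) : R.pred a t =ᵐ[μ] m :=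
  hg.condExp_eq (past_le h) (R.measurable_state t) ((R.memLp_state t).integrable one_le_two)

theorem errCov_ae_eq (h : R.AdmissibleBefore t a)
    (hg : IsCondGaussian (R.past a t) μ (R.state t) m P) : R.errCov a t =ᵐ[μ] P := by
  have key : ∀ i j, μ[fun ω => R.err a t ω i * R.err a t ω j | R.past a t] =ᵐ[μ]
      fun ω => P ω i j := fun i j => by
    refine Filter.EventuallyEq.trans (condExp_congr_ae ?_)
      (hg.condExp_centered_mul (past_le h) (R.measurable_state t) (R.memLp_state t) i j)
    filter_upwards [pred_ae_eq h hg] with ω hω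
    rw [err, hω]
  have key' : ∀ᵐ ω ∂μ, ∀ i j, (μ[fun ω => R.err a t ω i * R.err a t ω j | R.past a t]) ω
      = P ω i j := by
    simp_rw [ae_all_iff]
    exact key
  filter_upwards [key'] with ω hω
  ext i j
  exact hω i j

theorem secondMoment_ae_eq (h : R.AdmissibleBefore t a)
    (hg : IsCondGaussian (R.past a t) μ (R.state t) m P) :
    R.secondMoment a t =ᵐ[μ] fun ω => ‖m ω‖ ^ 2 + (P ω).trace :=
  hg.condExp_norm_sq (past_le h) (R.measurable_state t) (R.memLp_state t)

end Moments

end LGDS.Realization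

/-! ### Nonlinearity in the second moment, the covariance and the action -/

theorem not_affine_sqrt_sub (c : ℝ) :
    ¬ ∃ L : ℝ →ᵃ[ℝ] ℝ, ∀ m : ℝ, c ≤ m → √(m - c) = L m := by
  rintro ⟨L, hL⟩
  -- The square root takes the values `0, 1, 2` at `c, c + 1, c + 4`, whereas an affine map with the
  -- first two values takes the value `4` at the third.
  have h0 := hL c le_rfl
  have h1 := hL (c + 1) (by linarith)
  have h4 := hL (c + 4) (by linarith)
  have h2 : L (c + 4) = L (AffineMap.lineMap c (c + 1) (4 : ℝ)) := by
    congr 1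
    rw [AffineMap.lineMap_apply]
    simp
    ring
  rw [AffineMap.apply_lineMap, AffineMap.lineMap_apply, ← h0, ← h1, ← h4] at h2
  rw [add_sub_cancel_left, add_sub_cancel_left, sub_self,
    show (4 : ℝ) = 2 ^ 2 by norm_num, Real.sqrt_sq (by norm_num)] at h2
  norm_num at h2

/-- A square root of `M - p w s / (c s + w)` is not affine in `s` near `0`. -/
theorem not_affine_sqrt_sub_div {M p w c α β δ : ℝ} (hM : 0 < M) (hp : 0 < p) (hw : 0 < w)
    (hδ : 0 < δ) (hc : 0 ≤ c) (hδM : p * (3 * δ) ≤ M)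
    (h : ∀ s : ℝ, 0 ≤ s → p * s ≤ M → √(M - p * w * s / (c * s + w)) = α + β * s) : False := by
  -- Squaring and clearing the denominator leaves a cubic in `s` that vanishes at `0, δ, 2δ, 3δ`;
  -- finite differences then extract its coefficients.
  have key : ∀ s : ℝ, 0 ≤ s → p * s ≤ M →
      (c * s + w) * ((α + β * s) ^ 2 - M) + p * w * s = 0 := by
    intro s hs hps
    have hd : 0 < c * s + w := by positivity
    have hle : p * w * s / (c * s + w) ≤ M := by
      rw [div_le_iff₀ hd]
      nlinarith [mul_nonneg hM.le (mul_nonneg hc hs)]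
    rw [← h s hs hps, Real.sq_sqrt (by linarith)]
    field_simp
    ring
  have k0 := key 0 le_rfl (by simpa using hM.le)
  have k1 := key δ hδ.le (by nlinarith)
  have k2 := key (2 * δ) (by positivity) (by nlinarith)
  have k3 := key (3 * δ) (by positivity) hδM
  have hα : α ^ 2 = M := by
    have : w * (α ^ 2 - M) = 0 := by linear_combination k0
    rcases mul_eq_zero.1 this with h | h <;> linarith
  have c3 : c * β ^ 2 = 0 := by
    have : δ ^ 3 * (c * β ^ 2) = 0 := by linear_combination (k3 - 3 * k2 + 3 * k1 - k0) / 6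
    exact (mul_eq_zero.1 this).resolve_left (by positivity)
  have c2 : 2 * α * β * c + w * β ^ 2 = 0 := by
    have : δ ^ 2 * (2 * α * β * c + w * β ^ 2) = 0 := by
      linear_combination (k2 - 2 * k1 + k0) / 2 - 3 * δ ^ 3 * c3
    exact (mul_eq_zero.1 this).resolve_left (by positivity)
  have hβ : β = 0 := by
    by_contra hβ
    have hc0 : c = 0 := (mul_eq_zero.1 c3).resolve_right (pow_ne_zero 2 hβ)
    rw [hc0] at c2
    have : w * β ^ 2 = 0 := by linear_combination c2
    rcases mul_eq_zero.1 this with h | h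
    · exact hw.ne' h
    · exact pow_ne_zero 2 hβ h
  have : p * w * δ = 0 := by
    rw [hβ] at k1
    linear_combination k1 - (c * δ + w) * hα
  have : 0 < p * w * δ := by positivity
  linarith

/-- On the ray of multiples of `v vᵀ` the posterior covariance stays on the ray, so the matrix
problem becomes a scalar rational function of `s`. -/
theorem LGDS.trace_g_smul_vecMulVec {d : ℕ} (M : LGDS d) (v : Fin d → ℝ)
    (a : EuclideanSpace ℝ (Fin d)) {s : ℝ} (hs : 0 ≤ s) :
    (M.g (s • vecMulVec v v) a).trace = M.Q.trace
      + (M.Γ *ᵥ v ⬝ᵥ M.Γ *ᵥ v) * M.σ ^ 2 * s / ((a.ofLp ⬝ᵥ v) ^ 2 * s + M.σ ^ 2) := by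
  have hσ := pow_pos M.σ_pos 2
  have hd : s * (a.ofLp ⬝ᵥ v) ^ 2 + M.σ ^ 2 ≠ 0 := by positivity
  have hd' : (a.ofLp ⬝ᵥ v) ^ 2 * s + M.σ ^ 2 ≠ 0 := by positivity
  have h1 : a.ofLp ⬝ᵥ (s • vecMulVec v v) *ᵥ a.ofLp = s * (a.ofLp ⬝ᵥ v) ^ 2 := by
    rw [smul_mulVec, vecMulVec_mulVec, dotProduct_smul, op_smul_eq_smul, dotProduct_smul,
      dotProduct_comm v]
    simp only [smul_eq_mul]
    ring
  have h2 : posteriorCov (s • vecMulVec v v) a.ofLp (M.σ ^ 2)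
      = (M.σ ^ 2 * s / ((a.ofLp ⬝ᵥ v) ^ 2 * s + M.σ ^ 2)) • vecMulVec v v := by
    rw [posteriorCov, h1]
    have h3 : vecMulVec v v * vecMulVec a.ofLp a.ofLp * vecMulVec v v
        = (a.ofLp ⬝ᵥ v) ^ 2 • vecMulVec v v := by
      simp only [vecMulVec_mul_vecMulVec, vecMulVec_smul, Matrix.smul_mul, smul_smul]
      rw [dotProduct_comm v, sq]
    rw [Matrix.smul_mul, Matrix.smul_mul, Matrix.mul_smul, h3, smul_smul, smul_smul, smul_smul, ← sub_smul]
    congr 1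
    rw [mul_comm _ s] at hd' ⊢
    field_simp
    ring
  rw [LGDS.g_eq, h2, trace_add, Matrix.mul_smul, Matrix.smul_mul, trace_smul, mul_vecMulVec,
    vecMulVec_mul, vecMul_transpose, trace_vecMulVec, smul_eq_mul]
  ring

theorem LGDS.not_affine_sqrt_sub_trace_g {d : ℕ} (M : LGDS d) (hΓ : M.Γ ≠ 0)
    (a : EuclideanSpace ℝ (Fin d)) {m : ℝ} (hm : M.Q.trace < m) :
    ¬ ∃ L : Matrix (Fin d) (Fin d) ℝ →ᵃ[ℝ] ℝ, ∀ P : Matrix (Fin d) (Fin d) ℝ,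
      P.PosSemidef → (M.g P a).trace ≤ m → √(m - (M.g P a).trace) = L P := by
  rintro ⟨L, hL⟩
  obtain ⟨v, hv⟩ : ∃ v, M.Γ *ᵥ v ≠ 0 := by
    by_contra! h
    exact hΓ (Matrix.ext_of_mulVec_single fun i => by rw [h, zero_mulVec])
  have hσ := pow_pos M.σ_pos 2
  set p := M.Γ *ᵥ v ⬝ᵥ M.Γ *ᵥ v with hpdef
  have hp : 0 < p := by
    have := dotProduct_star_self_pos_iff.2 hv
    simpa using this
  have hM : 0 < m - M.Q.trace := sub_pos.2 hm
  -- The slope is that of `L` along the ray, and `δ` puts the last sample point `3 δ` at the end of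
  -- the range `p s ≤ m - tr Q`.
  refine not_affine_sqrt_sub_div (M := m - M.Q.trace) (p := p) (w := M.σ ^ 2)
    (c := (a.ofLp ⬝ᵥ v) ^ 2) (α := L 0) (β := L (vecMulVec v v) - L 0)
    (δ := (m - M.Q.trace) / (3 * p)) hM hp hσ (by positivity) (sq_nonneg _)
    (le_of_eq (by field_simp)) fun s hs hps => ?_
  have hpsd : (s • vecMulVec v v).PosSemidef := by
    have := posSemidef_vecMulVec_self_star v
    rw [star_trivial] at this
    exact this.smul hs
  have htr := M.trace_g_smul_vecMulVec v a hs
  rw [← hpdef] at htr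
  have hd : 0 < (a.ofLp ⬝ᵥ v) ^ 2 * s + M.σ ^ 2 := by positivity
  have hle : p * M.σ ^ 2 * s / ((a.ofLp ⬝ᵥ v) ^ 2 * s + M.σ ^ 2) ≤ m - M.Q.trace := by
    rw [div_le_iff₀ hd]
    nlinarith [mul_nonneg hM.le (mul_nonneg (sq_nonneg (a.ofLp ⬝ᵥ v)) hs)]
  have h := hL _ hpsd (by rw [htr]; linarith)
  rw [htr, ← sub_sub] at h
  rw [h]
  have e : s • vecMulVec v v = AffineMap.lineMap (0 : Matrix (Fin d) (Fin d) ℝ)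
      (vecMulVec v v) s := by
    simp [AffineMap.lineMap_apply]
  rw [e, AffineMap.apply_lineMap, AffineMap.lineMap_apply]
  simp only [vsub_eq_sub, vadd_eq_add, smul_eq_mul]
  ring

/-- A common rank-one matrix determines the line of its vector, so all images `A b` are parallel. In
dimension at least two, some combination of two independent vectors is therefore killed by `A`. -/
theorem exists_norm_eq_one_mulVec_eq_zero {d : ℕ} (hd : 2 ≤ d) {A C : Matrix (Fin d) (Fin d) ℝ}
    {s : EuclideanSpace ℝ (Fin d) → ℝ} (hs : ∀ b, 0 < s b)
    (h : ∀ b : EuclideanSpace ℝ (Fin d), ‖b‖ = 1 →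
      (s b)⁻¹ • vecMulVec (A *ᵥ b.ofLp) (A *ᵥ b.ofLp) = C) :
    ∃ b : EuclideanSpace ℝ (Fin d), ‖b‖ = 1 ∧ A *ᵥ b.ofLp = 0 := by
  obtain ⟨e, f, he, hf, hef⟩ : ∃ e f : EuclideanSpace ℝ (Fin d), ‖e‖ = 1 ∧ ‖f‖ = 1 ∧
      ∀ r : ℝ, e - r • f ≠ 0 := by
    have : Nontrivial (Fin d) := Fin.nontrivial_iff_two_le.2 hd
    obtain ⟨i, j, hij⟩ := exists_pair_ne (Fin d)
    refine ⟨EuclideanSpace.single i 1, EuclideanSpace.single j 1, by simp, by simp, fun r h0 => ?_⟩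
    have h1 := congrArg (fun x : EuclideanSpace ℝ (Fin d) => x i) h0
    simp [hij] at h1
  by_cases hAf : A *ᵥ f.ofLp = 0
  · exact ⟨f, hf, hAf⟩
  obtain ⟨k, hk⟩ : ∃ k, (A *ᵥ f.ofLp) k ≠ 0 := by
    by_contra! h0
    exact hAf (funext h0)
  have hC : ∀ l, (s e)⁻¹ * ((A *ᵥ e.ofLp) k * (A *ᵥ e.ofLp) l)
      = (s f)⁻¹ * ((A *ᵥ f.ofLp) k * (A *ᵥ f.ofLp) l) := fun l => by
    have h1 := congrFun (congrFun ((h e he).trans (h f hf).symm) k) l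
    simpa [vecMulVec_apply] using h1
  have hs1 := hs e
  have hs2 := hs f
  have hek : (A *ᵥ e.ofLp) k ≠ 0 := by
    intro h0
    have h1 := hC k
    rw [h0, zero_mul, mul_zero] at h1
    have : (s f)⁻¹ * ((A *ᵥ f.ofLp) k * (A *ᵥ f.ofLp) k) ≠ 0 := by positivity
    exact this h1.symm
  obtain ⟨r, hr⟩ : ∃ r, r * (s f * (A *ᵥ e.ofLp) k) = s e * (A *ᵥ f.ofLp) k :=
    ⟨_, div_mul_cancel₀ _ (mul_ne_zero hs2.ne' hek)⟩
  have hx : A *ᵥ (e - r • f).ofLp = 0 := by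
    ext l
    have h1 : s f * ((A *ᵥ e.ofLp) k * (A *ᵥ e.ofLp) l)
        = s e * ((A *ᵥ f.ofLp) k * (A *ᵥ f.ofLp) l) := by
      have h2 := hC l
      rw [inv_mul_eq_iff_eq_mul₀ hs1.ne', mul_left_comm, eq_inv_mul_iff_mul_eq₀ hs2.ne'] at h2
      exact h2
    rw [WithLp.ofLp_sub, WithLp.ofLp_smul, mulVec_sub, mulVec_smul, Pi.sub_apply, Pi.smul_apply,
      smul_eq_mul, Pi.zero_apply]
    have h3 : (s f * (A *ᵥ e.ofLp) k) * ((A *ᵥ e.ofLp) l - r * (A *ᵥ f.ofLp) l) = 0 := by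
      linear_combination h1 - (A *ᵥ f.ofLp) l * hr
    exact (mul_eq_zero.1 h3).resolve_left (mul_ne_zero hs2.ne' hek)
  refine ⟨‖e - r • f‖⁻¹ • (e - r • f), by
    rw [norm_smul, norm_inv, norm_norm, inv_mul_cancel₀ (norm_ne_zero_iff.2 (hef r))], ?_⟩
  rw [WithLp.ofLp_smul, mulVec_smul, hx, smul_zero]

theorem LGDS.not_affine_g {d : ℕ} (M : LGDS d) (hd : 2 ≤ d) (hΓ : M.Γ ≠ 0)
    (hcon : IsControllable M.Γ (CFC.sqrt M.Q)) {P : Matrix (Fin d) (Fin d) ℝ}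
    (hP : P.PosSemidef) (hPQ : (P - M.Q).PosSemidef) :
    ¬ ∃ L : EuclideanSpace ℝ (Fin d) →ᵃ[ℝ] Matrix (Fin d) (Fin d) ℝ,
      ∀ b : EuclideanSpace ℝ (Fin d), ‖b‖ = 1 → M.g P b = L b := by
  rintro ⟨L, hL⟩
  have hT : Pᵀ = P := by simpa using hP.isHermitian.eq
  have hσ := pow_pos M.σ_pos 2
  let s : EuclideanSpace ℝ (Fin d) → ℝ := fun b => b.ofLp ⬝ᵥ P *ᵥ b.ofLp + M.σ ^ 2
  have hs : ∀ b, 0 < s b := fun b => by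
    have : 0 ≤ b.ofLp ⬝ᵥ (P *ᵥ b.ofLp) := by simpa using hP.dotProduct_mulVec_nonneg b.ofLp
    positivity
  have hgs : ∀ b : EuclideanSpace ℝ (Fin d), M.g P b = M.Γ * P * M.Γᵀ + M.Q
      - (s b)⁻¹ • vecMulVec ((M.Γ * P) *ᵥ b.ofLp) ((M.Γ * P) *ᵥ b.ofLp) := fun b => by
    have : M.Γ * P * vecMulVec b.ofLp b.ofLp * P * M.Γᵀ
        = vecMulVec ((M.Γ * P) *ᵥ b.ofLp) ((M.Γ * P) *ᵥ b.ofLp) := by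
      have h1 : (M.Γ * P)ᵀ = P * M.Γᵀ := by rw [transpose_mul, hT]
      rw [Matrix.mul_assoc _ P M.Γᵀ, mul_vecMulVec, vecMulVec_mul, ← h1, vecMul_transpose]
    rw [LGDS.g, this]
  have heven : ∀ b, M.g P (-b) = M.g P b := fun b => by
    rw [hgs, hgs]
    simp only [s, WithLp.ofLp_neg, mulVec_neg, dotProduct_neg, neg_dotProduct, neg_neg,
      vecMulVec_neg, neg_vecMulVec]
  have hconst : ∀ b : EuclideanSpace ℝ (Fin d), ‖b‖ = 1 → M.g P b = L 0 := fun b hb => by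
    have h1 := hL b hb
    have h2 := hL (-b) (by rwa [norm_neg])
    rw [heven] at h2
    -- The origin is the midpoint of `b` and `-b`, where the even map takes the same value; hence
    -- that value is `L 0`.
    have h3 : L 0 = L (AffineMap.lineMap b (-b) (1 / 2 : ℝ)) := by
      congr 1
      rw [AffineMap.lineMap_apply]
      simp only [vsub_eq_sub, vadd_eq_add]
      module
    rw [AffineMap.apply_lineMap, ← h1, ← h2, AffineMap.lineMap_same_apply] at h3
    exact h3.symm
  have hC : ∀ b : EuclideanSpace ℝ (Fin d), ‖b‖ = 1 →
      (s b)⁻¹ • vecMulVec ((M.Γ * P) *ᵥ b.ofLp) ((M.Γ * P) *ᵥ b.ofLp)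
        = M.Γ * P * M.Γᵀ + M.Q - L 0 := fun b hb => by
    rw [← hconst b hb, hgs b]
    abel
  obtain ⟨b₀, hb₀, hz⟩ := exists_norm_eq_one_mulVec_eq_zero hd hs hC
  have hC0 : M.Γ * P * M.Γᵀ + M.Q - L 0 = 0 := by
    rw [← hC b₀ hb₀, hz, vecMulVec_zero, smul_zero]
  have hΓP : M.Γ * P = 0 := by
    refine Matrix.ext_of_mulVec_single fun i => ?_
    have h1 := hC (EuclideanSpace.single i 1) (by simp)
    rw [hC0] at h1
    have h2 := (smul_eq_zero.1 h1).resolve_left (inv_ne_zero (hs _).ne')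
    rw [zero_mulVec]
    have h3 : (EuclideanSpace.single i (1 : ℝ)).ofLp = Pi.single i 1 := rfl
    rw [h3] at h2
    ext k
    have h4 := congrFun (congrFun h2 k) k
    simpa [vecMulVec_apply] using h4
  -- As `Γ P = 0`, the semidefinite matrix `Γ (P - Q) Γᵀ` equals `-Γ Q Γᵀ`, so `Γ Q Γᵀ` is both
  -- nonnegative and nonpositive.
  have hΓQ : M.Γ * M.Q * M.Γᵀ = 0 := by
    have h1 : (M.Γ * (P - M.Q) * M.Γᵀ).PosSemidef := by
      simpa using hPQ.mul_mul_conjTranspose_same M.Γ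
    have h2 : (M.Γ * M.Q * M.Γᵀ).PosSemidef := by
      simpa using M.Q_psd.mul_mul_conjTranspose_same M.Γ
    rw [Matrix.mul_sub, hΓP, zero_sub, Matrix.neg_mul] at h1
    exact le_antisymm (by simpa [Matrix.le_iff] using h1) h2.nonneg
  set B := CFC.sqrt M.Q with hB
  have hBB : B * B = M.Q := CFC.sqrt_mul_sqrt_self _ M.Q_psd.nonneg
  have hBT : Bᵀ = B := by
    have : B.PosSemidef := (CFC.sqrt_nonneg M.Q).posSemidef
    simpa using this.isHermitian.eq
  have hΓB : M.Γ * B = 0 := by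
    rw [← self_mul_conjTranspose_eq_zero, conjTranspose_eq_transpose_of_trivial, transpose_mul,
      hBT, Matrix.mul_assoc, ← Matrix.mul_assoc B, hBB, ← Matrix.mul_assoc, hΓQ]
  refine hΓ (Matrix.ext_of_mulVec_single fun i => ?_)
  -- Since `Γ Γ^k B = Γ^k (Γ B) = 0`, the controllable subspace lies in the kernel of `Γ`.
  have hle : (⨆ k : Fin d, LinearMap.range (Matrix.mulVecLin (M.Γ ^ (k : ℕ) * B)))
      ≤ LinearMap.ker M.Γ.mulVecLin := by
    refine iSup_le fun k => ?_
    rintro _ ⟨y, rfl⟩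
    rw [LinearMap.mem_ker, mulVecLin_apply, mulVecLin_apply, mulVec_mulVec, ← Matrix.mul_assoc,
      ← pow_succ', pow_succ, Matrix.mul_assoc, hΓB, Matrix.mul_zero, zero_mulVec]
  rw [hcon] at hle
  have : Pi.single i 1 ∈ LinearMap.ker M.Γ.mulVecLin := hle trivial
  rw [LinearMap.mem_ker, mulVecLin_apply] at this
  rw [this, zero_mulVec]

/-! ### Maxima for the almost sure order -/

section AEMax

variable {Ω : Type*} [MeasurableSpace Ω] {μ : Measure Ω} {S : Set (Ω → ℝ)} {V W : Ω → ℝ}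

theorem IsAEMax.ae_eq (hV : IsAEMax μ S V) (hW : IsAEMax μ S W) : V =ᵐ[μ] W := by
  obtain ⟨f, hf, hVf⟩ := hV.2
  obtain ⟨g, hg, hWg⟩ := hW.2
  filter_upwards [hVf, hWg, hV.1 g hg, hW.1 f hf] with ω h1 h2 h3 h4
  exact le_antisymm (h1.le.trans h4) (h2.le.trans h3)

theorem IsAEMax.congr (hV : IsAEMax μ S V) (h : W =ᵐ[μ] V) : IsAEMax μ S W := by
  obtain ⟨f, hf, hVf⟩ := hV.2
  exact ⟨fun g hg => (hV.1 g hg).trans h.symm.le, f, hf, h.trans hVf⟩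

theorem IsAEMax.aeMax_ae_eq (hV : IsAEMax μ S V) : aeMax μ S =ᵐ[μ] V := by
  have h : ∃ V, IsAEMax μ S V := ⟨V, hV⟩
  rw [aeMax, dif_pos h]
  exact h.choose_spec.ae_eq hV

/-- Replaces conditional expectations by explicit representatives `J`. Only one competitor is
compared at a time, so an uncountable family of null sets does no harm. -/
theorem isAEMax_of_ae_eq {ι : Type*} {A : ι → Prop} {f J : ι → Ω → ℝ}
    (hfJ : ∀ α, A α → f α =ᵐ[μ] J α) {α₀ : ι} (hα₀ : A α₀) (hmax : ∀ α, A α → J α ≤ᵐ[μ] J α₀) :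
    IsAEMax μ {g | ∃ α, A α ∧ g = f α} (J α₀) := by
  refine ⟨?_, f α₀, ⟨α₀, hα₀, rfl⟩, (hfJ α₀ hα₀).symm⟩
  rintro _ ⟨α, hα, rfl⟩
  exact (hfJ α hα).le.trans (hmax α hα)

end AEMax

/-! ### Dynamic programming at the last two stages -/

namespace LGDS.Realization

variable {d : ℕ} {M : LGDS d} {Ω : Type*} [MeasurableSpace Ω] {μ : Measure Ω}
  {R : M.Realization μ} {a : ℕ → Ω → EuclideanSpace ℝ (Fin d)} {t : ℕ}
  {α : Ω → EuclideanSpace ℝ (Fin d)}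

theorem past_update : R.past (Function.update a t α) t = R.past a t :=
  past_congr fun _ hs => Function.update_of_ne hs.ne _ _

theorem AdmissibleBefore.update (h : R.AdmissibleBefore t a) (hα : R.IsAction a t α) :
    R.AdmissibleBefore (t + 1) (Function.update a t α) := by
  intro s hs
  rcases Nat.lt_succ_iff_lt_or_eq.1 hs with hst | rfl
  · have hp : R.past (Function.update a t α) s = R.past a s :=
      past_congr fun r hr => Function.update_of_ne (hr.trans hst).ne _ _
    rw [IsAction, hp, Function.update_of_ne hst.ne]
    exact h s hst
  · rw [IsAction, past_update, Function.update_self]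
    exact hα

theorem measurable_pred : Measurable[R.past a t] (R.pred a t) :=
  stronglyMeasurable_condExp.measurable

theorem integrable_norm_pred : Integrable (fun ω => ‖R.pred a t ω‖) μ :=
  integrable_condExp.norm

variable [IsProbabilityMeasure μ]

/-- An action already taken supplies a unit vector, which excludes `d = 0`. -/
theorem AdmissibleBefore.exists_norm_eq_one (h : R.AdmissibleBefore t a) (ht : t ≠ 0) :
    ∃ e : EuclideanSpace ℝ (Fin d), ‖e‖ = 1 := by
  obtain ⟨ω⟩ := nonempty_of_isProbabilityMeasure μ
  exact ⟨a 0 ω, (h 0 (Nat.pos_of_ne_zero ht)).2 ω⟩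

theorem integrable_inner_state (h : R.AdmissibleBefore t a) (hα : R.IsAction a t α) :
    Integrable (fun ω => inner ℝ (α ω) (R.state t ω)) μ := by
  have hz := (R.memLp_state t).integrable one_le_two
  refine hz.norm.mono' (Measurable.inner (hα.1.mono (past_le h) le_rfl)
    (R.measurable_state t)).aestronglyMeasurable ?_
  filter_upwards with ω
  simpa [hα.2 ω] using norm_inner_le_norm (𝕜 := ℝ) (α ω) (R.state t ω)

theorem condExp_inner_state (h : R.AdmissibleBefore t a) (hα : R.IsAction a t α) :
    μ[fun ω => inner ℝ (α ω) (R.state t ω) | R.past a t]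
      =ᵐ[μ] fun ω => inner ℝ (α ω) (R.pred a t ω) :=
  condExp_bilin_of_stronglyMeasurable_left (innerSL ℝ) hα.1.stronglyMeasurable
    (integrable_inner_state h hα) ((R.memLp_state t).integrable one_le_two)

theorem valueToGo_zero_ae_eq (h : R.AdmissibleBefore t a) (ht : t ≠ 0) :
    R.valueToGo 0 t a =ᵐ[μ] fun ω => ‖R.pred a t ω‖ := by
  classical
  obtain ⟨e, he⟩ := h.exists_norm_eq_one ht
  have hm := measurable_pred (R := R) (a := a) (t := t)
  -- The equality case of Cauchy–Schwarz; where the prediction vanishes every unit vector is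
  -- optimal, and `e` is a default.
  let α₀ : Ω → EuclideanSpace ℝ (Fin d) := fun ω =>
    if R.pred a t ω = 0 then e else ‖R.pred a t ω‖⁻¹ • R.pred a t ω
  have hα₀ : R.IsAction a t α₀ := by
    refine ⟨Measurable.ite (hm (measurableSet_singleton 0)) measurable_const
      ((measurable_norm.comp hm).inv.smul hm), fun ω => ?_⟩
    by_cases h0 : R.pred a t ω = 0
    · simp only [α₀, if_pos h0, he]
    · simp only [α₀, if_neg h0]
      rw [norm_smul, norm_inv, norm_norm, inv_mul_cancel₀ (norm_ne_zero_iff.2 h0)]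
  have hval : (fun ω => inner ℝ (α₀ ω) (R.pred a t ω)) = fun ω => ‖R.pred a t ω‖ := by
    ext ω
    by_cases h0 : R.pred a t ω = 0
    · simp [h0]
    · simp only [α₀, if_neg h0]
      rw [real_inner_smul_left, real_inner_self_eq_norm_sq, sq,
        inv_mul_cancel_left₀ (norm_ne_zero_iff.2 h0)]
  have hmax := isAEMax_of_ae_eq (μ := μ) (A := R.IsAction a t)
    (f := fun α => μ[fun ω => inner ℝ (α ω) (R.state t ω) | R.past a t])
    (J := fun α ω => inner ℝ (α ω) (R.pred a t ω)) (fun α hα => condExp_inner_state h hα) hα₀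
    (fun α hα => Filter.Eventually.of_forall fun ω => by
      have h1 := real_inner_le_norm (α ω) (R.pred a t ω)
      rw [hα.2 ω, one_mul] at h1
      exact h1.trans (congrFun hval ω).ge)
  rw [hval] at hmax
  exact hmax.aeMax_ae_eq

section Step

theorem errCov_update_ae_eq (h : R.AdmissibleBefore t a) (hα : R.IsAction a t α) :
    R.errCov (Function.update a t α) (t + 1) =ᵐ[μ] fun ω => M.g (R.errCov a t ω) (α ω) := by
  obtain ⟨m, P, hg, -⟩ := exists_isCondGaussian h
  have hb := h.update hα
  have hg' := hg
  rw [← past_update (α := α)] at hg'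
  filter_upwards [errCov_ae_eq hb (isCondGaussian_succ hb hg'), errCov_ae_eq h hg] with ω h1 h2
  rw [h1, h2, Function.update_self]

theorem radicand_ae_eq (h : R.AdmissibleBefore t a) (hα : R.IsAction a t α) :
    (fun ω => R.secondMoment (Function.update a t α) (t + 1) ω
        - (M.g (R.errCov a t ω) (α ω)).trace)
      =ᵐ[μ] fun ω => ‖R.pred (Function.update a t α) (t + 1) ω‖ ^ 2 := by
  obtain ⟨m, P, hg, -⟩ := exists_isCondGaussian (h.update hα)
  filter_upwards [errCov_update_ae_eq h hα, errCov_ae_eq (h.update hα) hg,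
    secondMoment_ae_eq (h.update hα) hg, pred_ae_eq (h.update hα) hg] with ω h1 h2 h3 h4
  rw [← h1, h2, h3, h4, add_sub_cancel_right]

theorem sqrt_radicand_ae_eq (h : R.AdmissibleBefore t a) (hα : R.IsAction a t α) :
    (fun ω => √(R.secondMoment (Function.update a t α) (t + 1) ω
        - (M.g (R.errCov a t ω) (α ω)).trace))
      =ᵐ[μ] fun ω => ‖R.pred (Function.update a t α) (t + 1) ω‖ := by
  filter_upwards [radicand_ae_eq h hα] with ω hω
  rw [hω, Real.sqrt_sq (norm_nonneg _)]

/-- The action enters the right side only through its value at `ω`, which is what allows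
maximization point by point. -/
theorem condExp_norm_pred_update (h : R.AdmissibleBefore t a) (hα : R.IsAction a t α)
    {m : Ω → EuclideanSpace ℝ (Fin d)} {P : Ω → Matrix (Fin d) (Fin d) ℝ}
    (hg : IsCondGaussian (R.past a t) μ (R.state t) m P) :
    μ[fun ω => ‖R.pred (Function.update a t α) (t + 1) ω‖ | R.past a t]
      =ᵐ[μ] fun ω => meanPredictedNorm M.Γ (M.σ ^ 2).toNNReal (m ω) (P ω) (α ω) := by
  have hb := h.update hα
  have hg' := hg
  rw [← past_update (α := α)] at hg'
  have hp := pred_ae_eq hb (isCondGaussian_succ hb hg')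
  simp only [Function.update_self] at hp
  have hn := hp.fun_comp norm
  simp only [Function.comp_def] at hn
  refine (condExp_congr_ae hn).trans (hg.condExp_norm_innovation (past_le h)
    (R.measurable_state t) (R.measurable_η t) (indep_η h) (R.law_η t) hα.1 M.Γ ?_)
  exact (integrable_congr hn).1 integrable_norm_pred

theorem isAEMax_value (h : R.AdmissibleBefore t a) (ht : t ≠ 0) :
    IsAEMax μ
      {f | ∃ α, R.IsAction a t α ∧
        f = fun ω => inner ℝ (α ω) (R.pred a t ω)
          + (μ[fun ω' => √(R.secondMoment (Function.update a t α) (t + 1) ω'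
              - (M.g (R.errCov a t ω') (α ω')).trace) | R.past a t]) ω}
      (R.value (t + 1) t a) := by
  obtain ⟨m, P, hg, -⟩ := exists_isCondGaussian h
  obtain ⟨e, he⟩ := h.exists_norm_eq_one ht
  have hne : Nonempty (Metric.sphere (0 : EuclideanSpace ℝ (Fin d)) 1) := ⟨⟨e, by simpa using he⟩⟩
  have hv : 0 < ((M.σ ^ 2).toNNReal : ℝ) :=
    NNReal.coe_pos.2 (Real.toNNReal_pos.2 (pow_pos M.σ_pos 2))
  let J : (Ω → EuclideanSpace ℝ (Fin d)) → Ω → ℝ := fun α ω => inner ℝ (α ω) (m ω)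
    + meanPredictedNorm M.Γ (M.σ ^ 2).toNNReal (m ω) (P ω) (α ω)
  -- The selection is made with `R.past a t` as the `σ`-algebra on `Ω`, so that the maximizer is an
  -- admissible action.
  obtain ⟨α₁, hα₁, hmax₁⟩ := @exists_measurable_argmax Ω
    (Metric.sphere (0 : EuclideanSpace ℝ (Fin d)) 1) (R.past a t) _ _ _ _ _
    (fun ω b => inner ℝ (b : EuclideanSpace ℝ (Fin d)) (m ω)
      + meanPredictedNorm M.Γ (M.σ ^ 2).toNNReal (m ω) (P ω) b)
    (fun b => (Measurable.inner measurable_const hg.measurable_mean).add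
      (measurable_meanPredictedNorm M.Γ _ hg.measurable_mean hg.measurable_cov measurable_const))
    (fun ω => (continuous_subtype_val.inner continuous_const).add
      (continuous_meanPredictedNorm M.Γ hv (m ω) (hg.posSemidef ω)))
  let α₀ : Ω → EuclideanSpace ℝ (Fin d) := fun ω => α₁ ω
  have hα₀ : R.IsAction a t α₀ :=
    ⟨measurable_subtype_coe.comp hα₁, fun ω => mem_sphere_zero_iff_norm.1 (α₁ ω).2⟩
  have hmax : ∀ α, R.IsAction a t α → J α ≤ᵐ[μ] J α₀ := fun α hα =>
    Filter.Eventually.of_forall fun ω => hmax₁ ω ⟨α ω, by simpa using hα.2 ω⟩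
  have hrhs : ∀ α, R.IsAction a t α → (fun ω => inner ℝ (α ω) (R.pred a t ω)
      + (μ[fun ω' => √(R.secondMoment (Function.update a t α) (t + 1) ω'
          - (M.g (R.errCov a t ω') (α ω')).trace) | R.past a t]) ω) =ᵐ[μ] J α := fun α hα => by
    filter_upwards [pred_ae_eq h hg, condExp_congr_ae (m := R.past a t) (sqrt_radicand_ae_eq h hα),
      condExp_norm_pred_update h hα hg] with ω h1 h2 h3
    rw [h1, h2, h3]
  have hval : ∀ α, R.IsAction a t α → μ[fun ω => inner ℝ (α ω) (R.state t ω)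
      + R.valueToGo 0 (t + 1) (Function.update a t α) ω | R.past a t] =ᵐ[μ] J α := fun α hα => by
    have h0 := valueToGo_zero_ae_eq (h.update hα) t.succ_ne_zero
    have hadd := condExp_add (m := R.past a t) (integrable_inner_state h hα)
      ((integrable_congr h0).2 integrable_norm_pred)
    filter_upwards [hadd, condExp_inner_state h hα, condExp_congr_ae (m := R.past a t) h0,
      condExp_norm_pred_update h hα hg, pred_ae_eq h hg] with ω h1 h2 h3 h4 h5
    refine h1.trans ?_
    rw [Pi.add_apply, h2, h3, h4, h5]
  have hV := (isAEMax_of_ae_eq hval hα₀ hmax).aeMax_ae_eq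
  refine (isAEMax_of_ae_eq hrhs hα₀ hmax).congr ?_
  rw [value, Nat.add_sub_cancel_left]
  exact hV

end Step

end LGDS.Realization

end

theorem theorem1 {d : ℕ} (M : LGDS d) {Ω : Type*} [MeasurableSpace Ω] (μ : Measure Ω)
    [IsProbabilityMeasure μ] (R : M.Realization μ) (n : ℕ) (hn : 2 ≤ n) :
    -- the last stage
    (∀ a, R.AdmissibleBefore n a →
      R.value n n a =ᵐ[μ] fun ω => ‖R.pred a n ω‖) ∧
    -- the stage `n - 1`
    (∀ a, R.AdmissibleBefore (n - 1) a →
      IsAEMax μ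
        {f | ∃ α, R.IsAction a (n - 1) α ∧
          f = fun ω => inner ℝ (α ω) (R.pred a (n - 1) ω)
            + (μ[fun ω' => √(R.secondMoment (Function.update a (n - 1) α) n ω'
                - (M.g (R.errCov a (n - 1) ω') (α ω')).trace) | R.past a (n - 1)]) ω}
        (R.value n (n - 1) a)) ∧
    -- the terms are well defined, and `g (P, α)` is the next error covariance matrix
    (∀ a, R.AdmissibleBefore (n - 1) a → ∀ α, R.IsAction a (n - 1) α →
      (∀ᵐ ω ∂μ, R.errCov (Function.update a (n - 1) α) n ω
          = M.g (R.errCov a (n - 1) ω) (α ω)) ∧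
      (∀ᵐ ω ∂μ, 0 ≤ R.secondMoment (Function.update a (n - 1) α) n ω
          - (M.g (R.errCov a (n - 1) ω) (α ω)).trace) ∧
      Integrable (fun ω => √(R.secondMoment (Function.update a (n - 1) α) n ω
          - (M.g (R.errCov a (n - 1) ω) (α ω)).trace)) μ) ∧
    -- nonlinearity in the second moment `m`
    (∀ a : EuclideanSpace ℝ (Fin d), ‖a‖ = 1 →
      ∀ P : Matrix (Fin d) (Fin d) ℝ, P.PosSemidef →
        ¬ ∃ L : ℝ →ᵃ[ℝ] ℝ, ∀ m : ℝ, (M.g P a).trace ≤ m → √(m - (M.g P a).trace) = L m) ∧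
    -- nonlinearity in the error covariance matrix `P`
    (M.Γ ≠ 0 → ∀ a : EuclideanSpace ℝ (Fin d), ‖a‖ = 1 → ∀ m : ℝ, M.Q.trace < m →
        ¬ ∃ L : Matrix (Fin d) (Fin d) ℝ →ᵃ[ℝ] ℝ, ∀ P : Matrix (Fin d) (Fin d) ℝ,
          P.PosSemidef → (M.g P a).trace ≤ m → √(m - (M.g P a).trace) = L P) ∧
    -- nonlinear dependence of the next error covariance matrix on the action
    (2 ≤ d → M.Γ ≠ 0 → IsControllable M.Γ (CFC.sqrt M.Q) →
      ∀ a, R.AdmissibleBefore (n - 1) a → ∀ᵐ ω ∂μ,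
        ¬ ∃ L : EuclideanSpace ℝ (Fin d) →ᵃ[ℝ] Matrix (Fin d) (Fin d) ℝ,
          ∀ b : EuclideanSpace ℝ (Fin d), ‖b‖ = 1 → M.g (R.errCov a (n - 1) ω) b = L b) := by
  obtain ⟨t, rfl⟩ : ∃ t, n = t + 1 := ⟨n - 1, by omega⟩
  -- This is where the horizon `n ≥ 2` enters: an action and a transition precede stage `n - 1`,
  -- giving a unit vector and `P ≥ Q`.
  have ht : t ≠ 0 := by omega
  simp only [Nat.add_sub_cancel]
  refine ⟨fun a ha => ?_, fun a ha => LGDS.Realization.isAEMax_value ha ht,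
    fun a ha α hα => ⟨LGDS.Realization.errCov_update_ae_eq ha hα, ?_, ?_⟩,
    fun a _ P _ => not_affine_sqrt_sub _,
    fun hΓ a _ m hm => M.not_affine_sqrt_sub_trace_g hΓ a hm, fun hd hΓ hcon a ha => ?_⟩
  · rw [LGDS.Realization.value, Nat.sub_self]
    exact LGDS.Realization.valueToGo_zero_ae_eq ha t.succ_ne_zero
  · filter_upwards [LGDS.Realization.radicand_ae_eq ha hα] with ω hω
    rw [hω]
    positivity
  · exact (integrable_congr (LGDS.Realization.sqrt_radicand_ae_eq ha hα)).2
      LGDS.Realization.integrable_norm_pred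
  · obtain ⟨m, P, hg, hPQ⟩ := LGDS.Realization.exists_isCondGaussian ha
    filter_upwards [LGDS.Realization.errCov_ae_eq ha hg] with ω hω
    rw [hω]
    exact M.not_affine_g hd hΓ hcon (hg.posSemidef ω) (hPQ ht ω)
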